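/- Let $(X,\rho,|\cdot|)$ be a homogeneous space: $\rho$ is a quasimetric ($\rho(x,y)=0$ iff $x=y$, $\rho$ is symmetric, and $\rho(x,z)\le C_0(\rho(x,y)+\rho(y,z))$ for some $C_0>0$), and $|\cdot|$ is a positive measure for which the balls $B(x,r)=\{y:\rho(x,y)<r\}$ are measurable and $0<|B(x,2r)|\le C_d|B(x,r)|<\infty$ for all $x\in X$, $r>0$. Write $\operatorname{diam}(E)=\sup_{x,y\in E}\rho(x,y)$. A dyadic decomposition of $X$ with constants $C>0$, $\delta\in(0,1)$, $\epsilon\in(0,1)$ is a family $S=\bigcup_{m\in\mathbb Z}S_m$ of measurable sets (cubes; a cube $Q\in S_m$ carries its level $k(Q)=m$) with points $x_c(Q)$, such that: $|X\setminus\bigcup_{Q\in S_m}Q|=0$ for all $m$; any two cubes are disjoint or one contains the other; each $Q\in S_m$ contains at least one cube of $S_{m+1}$ (a child) and is contained in exactly one cube of $S_{m-1}$; $|Q'|\ge\epsilon|Q|$ if $Q'$ is a child of $Q$; and $B(x_c(Q),\delta^m)\subset Q\subset B(x_c(Q),C\delta^m)$ for $Q\in S_m$. For $\lambda>1$ put $\lambda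 Q=B(x_c(Q),\lambda C\delta^{k(Q)})$. Let $S$ and $T$ be dyadic decompositions of $X$, with constants $C,\delta,\epsilon$ and $C',\delta',\epsilon'$ respectively, and let $D>0$, $k\in\{1,2,\dots\}$, $Q_0\in S$. Let $S(Q_0)=\bigcup_{n\ge0}\mathcal C_n$ be sparse in $Q_0$: all its elements are cubes of $S$ contained in $Q_0$; the elements of each $\mathcal C_n$ are pairwise disjoint; $\mathcal C_0=\{Q_0\}$; each element of $\mathcal C_{n+1}$ is a subset of an element of $\mathcal C_n$; and $\big|Q_1\cap\bigcup_{Q\in\mathcal C_{n+1}}Q\big|\le|Q_1|/2$ for all $Q_1\in\mathcal C_n$. Let $S'(Q_0)\subset S(Q_0)$ and suppose that for each $Q\in S'(Q_0)$ a cube $Q^*\in T$ is given with $2^kQ\subset Q^*$ and $\operatorname{diam}(Q^*)\le D\,2^kC\delta^{k(Q)}$. Define $$Bf=\sum_{Q\in S'(Q_0)}\Big(\frac1{|Q^*|}\int_{Q^*}f\Big)\chi_Q,\qquad B^*f=\sum_{Q\in S'(Q_0)}\Big(\frac1{|Q^*|}\int_{Q}f\Big)\chi_{Q^*}.$$ An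 $A_2$ weight is a nonnegative function $w$, integrable on all balls and positive almost everywhere, with $$[w]_{A_2}=\sup_{x\in X,\ r>0}\Big(\frac1{|B(x,r)|}\int_{B(x,r)}w\Big)\Big(\frac1{|B(x,r)|}\int_{B(x,r)}w^{-1}\Big)<\infty .$$ Then there is a constant $D_7>0$, depending only on $(X,\rho,|\cdot|)$ and on $C,\delta,\epsilon,C',\delta',\epsilon',D$, such that for all $S$, $T$, $k$, $Q_0$, $S(Q_0)$, $S'(Q_0)$ and $Q\mapsto Q^*$ as above, every $A_2$ weight $w$ and every real-valued $f\in L^2(w)$: $f$ is integrable on $Q^*$ for each $Q\in S'(Q_0)$, the sums defining $Bf$ and $B^*f$ converge absolutely almost everywhere and belong to $L^2(w)$, and $$\|Bf\|_{L^2(w)}\le D_7\,k\,[w]_{A_2}\|f\|_{L^2(w)},\qquad \|B^*f\|_{L^2(w)}\le D_7\,k\,[w]_{A_2}\|f\|_{L^2(w)}.$$ -/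

import Mathlib

open MeasureTheory
open scoped ENNReal

/-- The ball `B(x, r) = {y : ρ(x, y) < r}` of a quasimetric `ρ`. -/
def qBall {X : Type*} (ρ : X → X → ℝ) (x : X) (r : ℝ) : Set X := {y | ρ x y < r}

/-- `(X, ρ, μ)` is a homogeneous space: `ρ` is a quasimetric with constant `C₀` and the
positive measure `μ` is doubling with constant `Cd`. Nonnegativity of `ρ` follows from the
three axioms. -/
structure IsHomogeneousSpace {X : Type*} [MeasurableSpace X] (ρ : X → X → ℝ) (μ : Measure X)
    (C₀ Cd : ℝ) : Prop where
  C₀_pos : 0 < C₀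
  eq_zero_iff : ∀ x y, ρ x y = 0 ↔ x = y
  symm : ∀ x y, ρ x y = ρ y x
  triangle : ∀ x y z, ρ x z ≤ C₀ * (ρ x y + ρ y z)
  measurableSet_ball : ∀ x r, MeasurableSet (qBall ρ x r)
  ball_pos : ∀ x r, 0 < r → 0 < μ (qBall ρ x (2 * r))
  doubling : ∀ x r, 0 < r → μ (qBall ρ x (2 * r)) ≤ ENNReal.ofReal Cd * μ (qBall ρ x r)
  ball_lt_top : ∀ x r, 0 < r → ENNReal.ofReal Cd * μ (qBall ρ x r) < ∞

/-- A dyadic decomposition of `X` with constants `C`, `δ`, `ε`. `cubes k` is the collection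
`S_k` of cubes of level `k` and `center k Q` is the point `x_c(Q)` of a cube `Q ∈ S_k`.
In a bounded space, or near isolated points, one set can be a cube of several levels; a cube
is therefore treated as a pair (level, set). -/
structure DyadicDecomposition {X : Type*} [MeasurableSpace X] (ρ : X → X → ℝ) (μ : Measure X)
    (C δ ε : ℝ) where
  cubes : ℤ → Set (Set X)
  center : ℤ → Set X → X
  measurableSet_cube : ∀ k, ∀ Q ∈ cubes k, MeasurableSet Q
  ae_cover : ∀ k, μ (⋃ Q ∈ cubes k, Q)ᶜ = 0
  nested : ∀ k l, ∀ Q₁ ∈ cubes k, ∀ Q₂ ∈ cubes l, Disjoint Q₁ Q₂ ∨ Q₁ ⊆ Q₂ ∨ Q₂ ⊆ Q₁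
  exists_child : ∀ k, ∀ Q₁ ∈ cubes k, ∃ Q₂ ∈ cubes (k + 1), Q₂ ⊆ Q₁
  existsUnique_parent : ∀ k, ∀ Q₁ ∈ cubes k, ∃! Q₃, Q₃ ∈ cubes (k - 1) ∧ Q₁ ⊆ Q₃
  child_measure : ∀ k, ∀ Q₁ ∈ cubes k, ∀ Q₂ ∈ cubes (k + 1), Q₂ ⊆ Q₁ →
    ENNReal.ofReal ε * μ Q₁ ≤ μ Q₂
  ball_subset : ∀ k, ∀ Q ∈ cubes k, qBall ρ (center k Q) (δ ^ k) ⊆ Q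
  subset_ball : ∀ k, ∀ Q ∈ cubes k, Q ⊆ qBall ρ (center k Q) (C * δ ^ k)

/-- The dilated set `lam Q = B(x_c(Q), lam C δ^k)` of the cube `Q = p.2` of level `k = p.1`. -/
def DyadicDecomposition.dilate {X : Type*} [MeasurableSpace X] {ρ : X → X → ℝ} {μ : Measure X}
    {C δ ε : ℝ} (S : DyadicDecomposition ρ μ C δ ε) (lam : ℝ) (p : ℤ × Set X) : Set X :=
  qBall ρ (S.center p.1 p.2) (lam * C * δ ^ p.1)

/-- The family `⋃ n, 𝒞 n` of cubes of `S` is sparse in the cube `q₀` of `S`. -/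
structure IsSparseFamily {X : Type*} [MeasurableSpace X] {ρ : X → X → ℝ} {μ : Measure X}
    {C δ ε : ℝ} (S : DyadicDecomposition ρ μ C δ ε) (q₀ : ℤ × Set X)
    (𝒞 : ℕ → Set (ℤ × Set X)) : Prop where
  mem_cubes : ∀ n, ∀ p ∈ 𝒞 n, p.2 ∈ S.cubes p.1 ∧ p.2 ⊆ q₀.2
  disjoint : ∀ n, ∀ p ∈ 𝒞 n, ∀ q ∈ 𝒞 n, p ≠ q → Disjoint p.2 q.2
  zero : 𝒞 0 = {q₀}
  subset_prev : ∀ n, ∀ p ∈ 𝒞 (n + 1), ∃ q ∈ 𝒞 n, p.2 ⊆ q.2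
  half : ∀ n, ∀ q ∈ 𝒞 n, μ ((⋃ p ∈ 𝒞 (n + 1), p.2) ∩ q.2) ≤ μ q.2 / 2

/-- The data defining a discrete operator of complexity `k`: a cube `Q₀ ∈ S`, a sparse family
`S(Q₀)` in `Q₀`, a subfamily `S'(Q₀)` of it, and for every `Q ∈ S'(Q₀)` a cube `Q^*` of a second
dyadic decomposition `T` with `2^k Q ⊆ Q^*` and `diam Q^* ≤ D 2^k C δ^{k(Q)}`. -/
structure DiscreteOperator {X : Type*} [MeasurableSpace X] {ρ : X → X → ℝ} {μ : Measure X}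
    {C δ ε C' δ' ε' : ℝ} (S : DyadicDecomposition ρ μ C δ ε)
    (T : DyadicDecomposition ρ μ C' δ' ε') (D : ℝ) (k : ℕ) where
  root : ℤ × Set X
  root_mem : root.2 ∈ S.cubes root.1
  layer : ℕ → Set (ℤ × Set X)
  sparse : IsSparseFamily S root layer
  family : Set (ℤ × Set X)
  family_subset : family ⊆ ⋃ n, layer n
  star : ℤ × Set X → Set X
  star_mem : ∀ p ∈ family, ∃ m, star p ∈ T.cubes m
  dilate_subset_star : ∀ p ∈ family, S.dilate (2 ^ k) p ⊆ star p
  diam_star : ∀ p ∈ family, ∀ x ∈ star p, ∀ y ∈ star p, ρ x y ≤ D * (2 ^ k * C * δ ^ p.1)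

namespace DiscreteOperator

variable {X : Type*} [MeasurableSpace X] {ρ : X → X → ℝ} {μ : Measure X}
  {C δ ε C' δ' ε' : ℝ} {S : DyadicDecomposition ρ μ C δ ε}
  {T : DyadicDecomposition ρ μ C' δ' ε'} {D : ℝ} {k : ℕ}

/-- The summand `(1/|Q^*|) ∫_{Q^*} f · χ_Q` of `B f`. -/
noncomputable def term (B : DiscreteOperator S T D k) (f : X → ℝ) (p : ℤ × Set X) : X → ℝ :=
  p.2.indicator fun _ => (∫ y in B.star p, f y ∂μ) / μ.real (B.star p)

/-- The summand `(1/|Q^*|) ∫_Q f · χ_{Q^*}` of `B^* f`. -/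
noncomputable def adjTerm (B : DiscreteOperator S T D k) (f : X → ℝ) (p : ℤ × Set X) : X → ℝ :=
  (B.star p).indicator fun _ => (∫ y in p.2, f y ∂μ) / μ.real (B.star p)

/-- The discrete operator `B f = ∑_{Q ∈ S'(Q₀)} (1/|Q^*|) ∫_{Q^*} f · χ_Q`. -/
noncomputable def op (B : DiscreteOperator S T D k) (f : X → ℝ) (x : X) : ℝ :=
  ∑' p : B.family, B.term f p x

/-- The formal adjoint `B^* f = ∑_{Q ∈ S'(Q₀)} (1/|Q^*|) ∫_Q f · χ_{Q^*}`. -/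
noncomputable def adj (B : DiscreteOperator S T D k) (f : X → ℝ) (x : X) : ℝ :=
  ∑' p : B.family, B.adjTerm f p x

end DiscreteOperator

/-- The `A₂` characteristic `[w]_{A₂}`, the supremum over all balls of the product of the means of
`w` and `w⁻¹`, where `w⁻¹ = ∞` at the zeros of `w`. -/
noncomputable def a2Char {X : Type*} [MeasurableSpace X] (ρ : X → X → ℝ) (μ : Measure X)
    (w : X → ℝ) : ℝ≥0∞ :=
  ⨆ (x : X) (r : ℝ) (_ : 0 < r),
    ((∫⁻ y in qBall ρ x r, ENNReal.ofReal (w y) ∂μ) / μ (qBall ρ x r)) *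
      ((∫⁻ y in qBall ρ x r, (ENNReal.ofReal (w y))⁻¹ ∂μ) / μ (qBall ρ x r))

/-- `w` is an `A₂` weight: nonnegative, locally integrable, with `[w]_{A₂} < ∞`. Positivity almost
everywhere only excludes `w = 0` a.e., for which the product of means would read `0 · ∞`. -/
structure IsA2Weight {X : Type*} [MeasurableSpace X] (ρ : X → X → ℝ) (μ : Measure X)
    (w : X → ℝ) : Prop where
  nonneg : ∀ x, 0 ≤ w x
  ae_pos : ∀ᵐ x ∂μ, 0 < w x
  integrableOn_ball : ∀ x r, 0 < r → IntegrableOn w (qBall ρ x r) μ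
  a2Char_lt_top : a2Char ρ μ w < ∞

/-- The measure `w dμ`, so that `L²(w)` is `L²` of this measure. -/
noncomputable def weighted {X : Type*} [MeasurableSpace X] (μ : Measure X) (w : X → ℝ) :
    Measure X :=
  μ.withDensity fun x => ENNReal.ofReal (w x)

/-! With `W = w` and `σ = w⁻¹`, both norm bounds reduce by duality to one estimate: the form `∑
⟨f⟩_{Q^*} ∫_Q g`, over a finite part of the family, is at most a multiple of `k [w]_{A₂} ‖f‖_{L²(W)}
‖g‖_{L²(σ)}`. The adjoint has the same form with `f`, `g` and the two weights exchanged, and the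
`A₂` condition is symmetric in `W` and `σ`.

For a sparse form `∑ ⟨f⟩_A ∫_A g` the bound linear in `[w]_{A₂}` is direct
(`IsDualPair.sq_sparse_form_le`). Write `∫_A f = u σ(A)` and `∫_A g = v W(A)`, use `W(A) σ(A) ≤ a
|A|²`, and replace `|A|` by twice the measure of the part of `A` outside its proper subsets in the
family. These parts are disjoint, and `u`, `v` are dominated by dyadic maximal functions relative to
`σ dμ` and `W dμ`. Doob's inequality bounds these with a constant independent of the weight.

The cubes `Q^*` need not be sparse, although the cubes `Q` are. The core is
`exists_sparse_domination`: a stopping time argument inside `T` dominates `∑ ⟨f⟩_{Q^*} χ_Q`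
pointwise by a sparse operator on cubes `Q^*`, at a cost linear in `k`. Below a maximal cube `F` the
selection stops where the average of `f` is large, or where too many fixed dilates `L` of cubes `Q`
contain the star. The stopped part covers at most half of `F`, by the definition of averages and by
Carleson packing of the `Q`. For the terms that remain at a point `x`, consider the smallest star
`A` among them: at most `m` of the dilates `L` contain `A`, and the other cubes `Q` contain `x` and
have `A ⊆ Q^*` but `A ⊄ L`. Such cubes have comparable scales and occupy `O(k)` levels
(`DiscreteOperator.card_le`). This count is the only source of the factor `k`. -/

/-! ### Finite laminar and sparse families of sets. -/

/-- Any two members of a finite family of sets are disjoint or nested. -/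
def IsLaminar {X : Type*} (𝓖 : Finset (Set X)) : Prop :=
  ∀ A ∈ 𝓖, ∀ B ∈ 𝓖, Disjoint A B ∨ A ⊆ B ∨ B ⊆ A

theorem IsLaminar.mono {X : Type*} {𝓖 𝓗 : Finset (Set X)} (h : IsLaminar 𝓖) (hs : 𝓗 ⊆ 𝓖) :
    IsLaminar 𝓗 :=
  fun A hA B hB => h A (hs hA) B (hs hB)

/-- A measure inequality on the members of a finite laminar family passes to their union. -/
theorem IsLaminar.mul_measure_biUnion_le {X : Type*} [MeasurableSpace X] {μ ν : Measure X}
    {c : ℝ≥0∞} {𝓖 : Finset (Set X)} (h𝓖 : IsLaminar 𝓖) (hm : ∀ A ∈ 𝓖, MeasurableSet A)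
    (h : ∀ A ∈ 𝓖, c * μ A ≤ ν A) : c * μ (⋃ A ∈ 𝓖, A) ≤ ν (⋃ A ∈ 𝓖, A) := by
  classical
  induction 𝓖 using Finset.strongInduction with
  | H 𝓖 ih =>
    rcases 𝓖.eq_empty_or_nonempty with rfl | hne
    · simp
    -- A maximal `F` contains every member that it meets, up to disjointness: members not inside `F`
    -- are disjoint from it, so the union splits and the induction removes `F` with all its subsets.
    obtain ⟨F, hF, hmax⟩ := Finset.exists_maximal hne
    set 𝓗 := 𝓖.filter fun A => ¬ A ⊆ F with h𝓗
    have hsub : 𝓗 ⊆ 𝓖 := Finset.filter_subset _ _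
    have hss : 𝓗 ⊂ 𝓖 := Finset.filter_ssubset.2 ⟨F, hF, by simp⟩
    have hU : (⋃ A ∈ 𝓖, A) = F ∪ ⋃ A ∈ 𝓗, A := by
      apply Set.Subset.antisymm
      · refine Set.iUnion₂_subset fun A hA => ?_
        by_cases hAF : A ⊆ F
        · exact hAF.trans Set.subset_union_left
        · exact (Set.subset_biUnion_of_mem (u := fun A : Set X => A)
            (show A ∈ 𝓗 by simp [h𝓗, hA, hAF])).trans Set.subset_union_right
      · refine Set.union_subset (Set.subset_biUnion_of_mem (u := fun A : Set X => A) hF) ?_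
        exact Set.biUnion_subset_biUnion_left hsub
    have hd : Disjoint F (⋃ A ∈ 𝓗, A) := by
      refine Set.disjoint_iUnion₂_right.2 fun A hA => ?_
      rw [h𝓗, Finset.mem_filter] at hA
      rcases h𝓖 F hF A hA.1 with h1 | h1 | h1
      · exact h1
      · exact absurd (hmax hA.1 h1) hA.2
      · exact absurd h1 hA.2
    have hmU : MeasurableSet (⋃ A ∈ 𝓗, A) :=
      Finset.measurableSet_biUnion _ fun A hA => hm A (hsub hA)
    rw [hU, measure_union hd hmU, measure_union hd hmU, mul_add]
    exact add_le_add (h F hF) (ih 𝓗 hss (h𝓖.mono hsub) (fun A hA => hm A (hsub hA))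
      fun A hA => h A (hsub hA))

/-- A finite laminar family in which the proper subsets of each member cover at most half of it. -/
structure IsFinSparse {X : Type*} [MeasurableSpace X] (μ : Measure X) (𝓖 : Finset (Set X)) :
    Prop where
  measurableSet : ∀ A ∈ 𝓖, MeasurableSet A
  laminar : IsLaminar 𝓖
  half : ∀ A ∈ 𝓖, μ (⋃ B ∈ 𝓖, ⋃ (_ : B ⊂ A), B) ≤ μ A / 2

/-- The part of `A` outside the members of `𝓖` that are proper subsets of `A`. -/
def ownPart {X : Type*} (𝓖 : Finset (Set X)) (A : Set X) : Set X :=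
  A \ ⋃ B ∈ 𝓖, ⋃ (_ : B ⊂ A), B

theorem ownPart_subset {X : Type*} (𝓖 : Finset (Set X)) (A : Set X) : ownPart 𝓖 A ⊆ A :=
  Set.sdiff_subset

namespace IsFinSparse

variable {X : Type*} [MeasurableSpace X] {μ : Measure X} {𝓖 : Finset (Set X)}

theorem measurableSet_ownPart (h : IsFinSparse μ 𝓖) {A : Set X} (hA : A ∈ 𝓖) :
    MeasurableSet (ownPart 𝓖 A) :=
  (h.measurableSet A hA).diff <| Finset.measurableSet_biUnion _ fun B hB =>
    MeasurableSet.iUnion fun _ => h.measurableSet B hB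

theorem pairwiseDisjoint_ownPart (h : IsFinSparse μ 𝓖) :
    (𝓖 : Set (Set X)).PairwiseDisjoint (ownPart 𝓖) := by
  have key : ∀ A ∈ 𝓖, ∀ B, A ⊂ B → Disjoint (ownPart 𝓖 A) (ownPart 𝓖 B) := by
    intro A hA B hAB
    refine Set.disjoint_left.2 fun x hx hx' => hx'.2 ?_
    simp only [Set.mem_iUnion]
    exact ⟨A, hA, hAB, hx.1⟩
  intro A hA B hB hne
  rcases h.laminar A hA B hB with h1 | h1 | h1
  · exact h1.mono (ownPart_subset _ _) (ownPart_subset _ _)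
  · exact key A hA B (h1.ssubset_of_ne hne)
  · exact (key B hB A (h1.ssubset_of_ne hne.symm)).symm

/-- The proper subsets take at most half of `A`, so its own part keeps the other half; finiteness
allows the cancellation. -/
theorem measure_le (h : IsFinSparse μ 𝓖) {A : Set X} (hA : A ∈ 𝓖) (hfin : μ A ≠ ∞) :
    μ A ≤ 2 * μ (ownPart 𝓖 A) := by
  have h1 : μ A ≤ μ (ownPart 𝓖 A) + μ A / 2 := by
    calc μ A ≤ μ (ownPart 𝓖 A ∪ ⋃ B ∈ 𝓖, ⋃ (_ : B ⊂ A), B) :=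
          measure_mono (by rw [ownPart, Set.sdiff_union_self]; exact Set.subset_union_left)
      _ ≤ _ := (measure_union_le _ _).trans (add_le_add le_rfl (h.half A hA))
  have h2 : μ A / 2 + μ A / 2 ≤ μ (ownPart 𝓖 A) + μ A / 2 := by rwa [ENNReal.add_halves]
  have h3 : μ A / 2 ≤ μ (ownPart 𝓖 A) :=
    (ENNReal.add_le_add_iff_right (ENNReal.div_ne_top hfin (by simp))).1 h2
  calc μ A = μ A / 2 + μ A / 2 := (ENNReal.add_halves _).symm
    _ ≤ _ := by rw [two_mul]; exact add_le_add h3 h3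

/-- Carleson packing. -/
theorem sum_measure_le (h : IsFinSparse μ 𝓖) {F : Set X} (hF : ∀ A ∈ 𝓖, A ⊆ F)
    (hfin : μ F ≠ ∞) : ∑ A ∈ 𝓖, μ A ≤ 2 * μ F := by
  calc ∑ A ∈ 𝓖, μ A ≤ ∑ A ∈ 𝓖, 2 * μ (ownPart 𝓖 A) := Finset.sum_le_sum fun A hA =>
        h.measure_le hA (ne_top_of_le_ne_top hfin (measure_mono (hF A hA)))
    _ = 2 * μ (⋃ A ∈ 𝓖, ownPart 𝓖 A) := by
        rw [← Finset.mul_sum, measure_biUnion_finset h.pairwiseDisjoint_ownPart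
          fun A hA => h.measurableSet_ownPart hA]
    _ ≤ 2 * μ F := by
        gcongr
        exact Set.iUnion₂_subset fun A hA => (ownPart_subset _ _).trans (hF A hA)

end IsFinSparse

/-! ### Cauchy–Schwarz for a pair of dual weights. -/

/-- The Cauchy–Schwarz inequality. -/
theorem sq_lintegral_mul_le {X : Type*} [MeasurableSpace X] {μ : Measure X} {f g : X → ℝ≥0∞}
    (hf : AEMeasurable f μ) (hg : AEMeasurable g μ) :
    (∫⁻ x, f x * g x ∂μ) ^ 2 ≤ (∫⁻ x, f x ^ 2 ∂μ) * ∫⁻ x, g x ^ 2 ∂μ := by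
  have h := ENNReal.lintegral_mul_le_Lp_mul_Lq μ Real.HolderConjugate.two_two hf hg
  simp only [Pi.mul_apply, ENNReal.rpow_two] at h
  calc (∫⁻ x, f x * g x ∂μ) ^ 2
      ≤ ((∫⁻ x, f x ^ 2 ∂μ) ^ (1 / 2 : ℝ) * (∫⁻ x, g x ^ 2 ∂μ) ^ (1 / 2 : ℝ)) ^ 2 := by gcongr
    _ = _ := by
        rw [mul_pow, ← ENNReal.rpow_natCast, ← ENNReal.rpow_natCast, ← ENNReal.rpow_mul,
          ← ENNReal.rpow_mul]
        norm_num

/-- The weights `W` and `σ` are inverse to each other almost everywhere. -/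
structure IsDualPair {X : Type*} [MeasurableSpace X] (μ : Measure X) (W σ : X → ℝ≥0∞) :
    Prop where
  left : AEMeasurable W μ
  right : AEMeasurable σ μ
  mul_eq_one : ∀ᵐ x ∂μ, W x * σ x = 1

namespace IsDualPair

variable {X : Type*} [MeasurableSpace X] {μ : Measure X} {W σ : X → ℝ≥0∞}

theorem symm (h : IsDualPair μ W σ) : IsDualPair μ σ W :=
  ⟨h.right, h.left, h.mul_eq_one.mono fun x hx => by rwa [mul_comm]⟩

theorem restrict (h : IsDualPair μ W σ) (s : Set X) : IsDualPair (μ.restrict s) W σ :=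
  ⟨h.left.restrict, h.right.restrict, ae_restrict_of_ae h.mul_eq_one⟩

/-- Insert `W^{1/2} σ^{1/2} = 1` and apply the unweighted inequality. -/
theorem sq_lintegral_mul_le (h : IsDualPair μ W σ) {f g : X → ℝ≥0∞}
    (hf : AEMeasurable f μ) (hg : AEMeasurable g μ) :
    (∫⁻ x, f x * g x ∂μ) ^ 2 ≤ (∫⁻ x, f x ^ 2 * W x ∂μ) * ∫⁻ x, g x ^ 2 * σ x ∂μ := by
  have hsq : ∀ t : ℝ≥0∞, (t ^ (1 / 2 : ℝ)) ^ 2 = t := fun t => by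
    rw [← ENNReal.rpow_natCast, ← ENNReal.rpow_mul]; norm_num
  have h1 := _root_.sq_lintegral_mul_le (hf.mul (h.left.pow_const (1 / 2 : ℝ)))
    (hg.mul (h.right.pow_const (1 / 2 : ℝ)))
  have h2 : ∫⁻ x, f x * g x ∂μ =
      ∫⁻ x, (f x * W x ^ (1 / 2 : ℝ)) * (g x * σ x ^ (1 / 2 : ℝ)) ∂μ := by
    refine lintegral_congr_ae (h.mul_eq_one.mono fun x hx => ?_)
    have : W x ^ (1 / 2 : ℝ) * σ x ^ (1 / 2 : ℝ) = 1 := by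
      rw [← ENNReal.mul_rpow_of_nonneg _ _ (by norm_num), hx, ENNReal.one_rpow]
    simp only
    rw [mul_mul_mul_comm, this, mul_one]
  rw [h2]
  simpa only [Pi.mul_apply, mul_pow, hsq] using h1

theorem measure_pos_ne_zero (h : IsDualPair μ W σ) {A : Set X} (hA : μ A ≠ 0) :
    ∫⁻ x in A, W x ∂μ ≠ 0 := by
  intro h0
  rw [lintegral_eq_zero_iff' h.left.restrict] at h0
  have : ∀ᵐ x ∂(μ.restrict A), False := by
    filter_upwards [h0, (h.restrict A).mul_eq_one] with x hx hx'
    simp [show W x = 0 from hx] at hx'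
  rw [Filter.eventually_false_iff_eq_bot, ae_eq_bot, Measure.restrict_eq_zero] at this
  exact hA this

/-- Cauchy–Schwarz for `f · 1` on `A`. This is what makes `f` integrable on the cubes `Q^*`. -/
theorem setLIntegral_ne_top (h : IsDualPair μ W σ) {f : X → ℝ≥0∞} (hf : AEMeasurable f μ)
    (hf2 : ∫⁻ x, f x ^ 2 * W x ∂μ ≠ ∞) {A : Set X} (hA : ∫⁻ x in A, σ x ∂μ ≠ ∞) :
    ∫⁻ x in A, f x ∂μ ≠ ∞ := by
  have h1 := (h.restrict A).sq_lintegral_mul_le hf.restrict (aemeasurable_const (b := 1))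
  simp only [mul_one, one_pow, one_mul] at h1
  have h2 : (∫⁻ x in A, f x ∂μ) ^ 2 ≠ ∞ := ne_top_of_le_ne_top
    (ENNReal.mul_ne_top (ne_top_of_le_ne_top hf2 (setLIntegral_le_lintegral _ _)) hA) h1
  simpa using h2

end IsDualPair

/-- The absorption step: cancelling `a` requires `a` finite, so its uses below are preceded by an a
priori finiteness proof. -/
theorem ENNReal.le_mul_of_sq_le_mul {a c b : ℝ≥0∞} (ha : a ≠ ∞) (h : a ^ 2 ≤ c * a * b) :
    a ≤ c * b := by
  rcases eq_or_ne a 0 with rfl | h0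
  · simp
  have : a * a ≤ a * (c * b) := by
    calc a * a = a ^ 2 := (sq a).symm
      _ ≤ c * a * b := h
      _ = _ := by ring
  exact (ENNReal.mul_le_mul_iff_right h0 ha).1 this

/-! ### Maximal inequalities. -/

/-- Doob's maximal inequality in `L²`, for a finite laminar family. -/
theorem IsLaminar.exists_maximal_function {X : Type*} [MeasurableSpace X] {ν : Measure X}
    {𝓖 : Finset (Set X)} (h𝓖 : IsLaminar 𝓖) (hm : ∀ A ∈ 𝓖, MeasurableSet A)
    (hfin : ∀ A ∈ 𝓖, ν A ≠ ∞) (h0 : ∀ A ∈ 𝓖, ν A ≠ 0) {h : X → ℝ≥0∞} (hh : AEMeasurable h ν)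
    (hh1 : ∀ A ∈ 𝓖, ∫⁻ x in A, h x ∂ν ≠ ∞) :
    ∃ M : X → ℝ≥0∞, Measurable M ∧ (∀ A ∈ 𝓖, ∀ x ∈ A, (∫⁻ y in A, h y ∂ν) / ν A ≤ M x) ∧
      ∫⁻ x, M x ^ 2 ∂ν ≤ 4 * ∫⁻ x, h x ^ 2 ∂ν := by
  classical
  set a : Set X → NNReal := fun A => ((∫⁻ y in A, h y ∂ν) / ν A).toNNReal with ha
  have haA : ∀ A ∈ 𝓖, (a A : ℝ≥0∞) = (∫⁻ y in A, h y ∂ν) / ν A := fun A hA =>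
    ENNReal.coe_toNNReal (ENNReal.div_ne_top (hh1 A hA) (h0 A hA))
  set M : X → NNReal := fun x => 𝓖.sup fun A => A.indicator (fun _ => a A) x with hM
  have hMm : Measurable M := by
    have h1 : Measurable (𝓖.sup fun A => A.indicator fun _ => a A) :=
      Finset.sup_induction (p := Measurable) measurable_const (fun _ hf _ hg => hf.sup hg)
        fun A hA => measurable_const.indicator (hm A hA)
    convert h1 using 1
    ext x
    simp [hM, Finset.sup_apply]
  have hle : ∀ A ∈ 𝓖, ∀ x ∈ A, a A ≤ M x := fun A hA x hx => by
    have := Finset.le_sup (f := fun A => A.indicator (fun _ => a A) x) hA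
    simpa [Set.indicator_of_mem hx] using this
  -- The superlevel set is a union of members on which the average exceeds `t`, so the laminar union
  -- inequality yields the weak type bound with `h` integrated over the same superlevel set.
  have hlevel : ∀ t : ℝ, 0 < t → {x | t < (M x : ℝ)} = ⋃ A ∈ 𝓖.filter (fun A => t < a A), A := by
    intro t ht
    ext x
    lift t to NNReal using ht.le
    simp only [Set.mem_ofPred_eq, NNReal.coe_lt_coe, hM, Finset.lt_sup_iff, Set.mem_iUnion,
      Finset.mem_filter, exists_prop]
    constructor
    · rintro ⟨A, hA, hx⟩
      by_cases hxA : x ∈ A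
      · exact ⟨A, ⟨hA, by simpa [hxA] using hx⟩, hxA⟩
      · simp [hxA] at hx
    · rintro ⟨A, ⟨hA, h1⟩, hx⟩
      exact ⟨A, hA, by simpa [hx] using h1⟩
  have hweak : ∀ t : ℝ, 0 < t → ν {x | t < (M x : ℝ)} * ENNReal.ofReal t ≤
      (ν.withDensity h) {x | t < (M x : ℝ)} := by
    intro t ht
    rw [hlevel t ht, mul_comm]
    refine (h𝓖.mono (Finset.filter_subset _ _)).mul_measure_biUnion_le
      (fun A hA => hm A (Finset.filter_subset _ _ hA)) fun A hA => ?_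
    rw [Finset.mem_filter] at hA
    rw [withDensity_apply _ (hm A hA.1)]
    refine ENNReal.mul_le_of_le_div ?_
    rw [← haA A hA.1, ← ENNReal.ofReal_coe_nnreal]
    exact ENNReal.ofReal_le_ofReal hA.2.le
  have hMr : Measurable fun x => (M x : ℝ) := hMm.coe_nnreal_real
  have hsq : ∫⁻ x, (M x : ℝ≥0∞) ^ 2 ∂ν =
      ∫⁻ t in Set.Ioi (0 : ℝ), ν {x | t < (M x : ℝ)} * ENNReal.ofReal (2 * t) := by
    rw [← lintegral_comp_eq_lintegral_meas_lt_mul ν (f := fun x => (M x : ℝ))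
      (g := fun t => 2 * t) (Filter.Eventually.of_forall fun x => (M x).coe_nonneg)
      hMr.aemeasurable (fun t _ => (by fun_prop : Continuous fun t : ℝ => 2 * t).intervalIntegrable
        _ _) ((ae_restrict_iff' measurableSet_Ioi).2 (Filter.Eventually.of_forall fun t ht => by
          have : (0 : ℝ) < t := ht
          change (0 : ℝ) ≤ 2 * t; linarith))]
    refine lintegral_congr fun x => ?_
    have : ∫ t in (0 : ℝ)..(M x : ℝ), 2 * t = ((M x ^ 2 : NNReal) : ℝ) := by
      rw [intervalIntegral.integral_const_mul, integral_id]; push_cast; ring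
    rw [this, ENNReal.ofReal_coe_nnreal]
    push_cast; rfl
  have hlin : ∫⁻ x, M x * h x ∂ν =
      ∫⁻ t in Set.Ioi (0 : ℝ), (ν.withDensity h) {x | t < (M x : ℝ)} := by
    rw [← lintegral_eq_lintegral_meas_lt (ν.withDensity h) (f := fun x => (M x : ℝ))
      (Filter.Eventually.of_forall fun x => (M x).coe_nonneg) hMr.aemeasurable]
    simp only [ENNReal.ofReal_coe_nnreal]
    rw [lintegral_withDensity_eq_lintegral_mul₀ hh hMm.coe_nnreal_ennreal.aemeasurable]
    exact lintegral_congr fun x => mul_comm _ _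
  -- Layer cake applied to both sides of the weak type bound. Cauchy–Schwarz and absorption then
  -- give the constant `4 = 2²`.
  have hkey : ∫⁻ x, (M x : ℝ≥0∞) ^ 2 ∂ν ≤ 2 * ∫⁻ x, M x * h x ∂ν := by
    rw [hsq, hlin, ← lintegral_const_mul' _ _ (by simp)]
    refine setLIntegral_mono' measurableSet_Ioi fun t ht => ?_
    have ht' : (0 : ℝ) < t := ht
    rw [ENNReal.ofReal_mul (by norm_num), mul_left_comm]
    simpa using mul_le_mul_right (hweak t ht') 2
  have hMfin : ∫⁻ x, (M x : ℝ≥0∞) ^ 2 ∂ν ≠ ∞ := by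
    refine ne_top_of_le_ne_top ?_ (lintegral_mono (g := fun x => ∑ A ∈ 𝓖,
      A.indicator (fun _ => (a A : ℝ≥0∞) ^ 2) x) fun x => ?_)
    · rw [lintegral_finsetSum _ fun A hA => measurable_const.indicator (hm A hA)]
      refine ENNReal.sum_ne_top.2 fun A hA => ?_
      rw [lintegral_indicator (hm A hA), setLIntegral_const]
      exact ENNReal.mul_ne_top (by simp) (hfin A hA)
    · rcases 𝓖.eq_empty_or_nonempty with rfl | hne
      · simp [hM]
      obtain ⟨A, hA, hAx⟩ := Finset.exists_mem_eq_sup 𝓖 hne fun A => A.indicator (fun _ => a A) x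
      have : (M x : ℝ≥0∞) ^ 2 = A.indicator (fun _ => (a A : ℝ≥0∞) ^ 2) x := by
        rw [hM]; simp only; rw [hAx]
        by_cases hx : x ∈ A <;> simp [hx]
      simp only
      rw [this]
      exact Finset.single_le_sum (f := fun A => A.indicator (fun _ => (a A : ℝ≥0∞) ^ 2) x)
        (fun _ _ => zero_le) hA
  refine ⟨fun x => M x, hMm.coe_nnreal_ennreal, fun A hA x hx => ?_, ?_⟩
  · rw [← haA A hA]; exact ENNReal.coe_le_coe.2 (hle A hA x hx)
  · refine ENNReal.le_mul_of_sq_le_mul hMfin ?_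
    calc (∫⁻ x, (M x : ℝ≥0∞) ^ 2 ∂ν) ^ 2 ≤ (2 * ∫⁻ x, M x * h x ∂ν) ^ 2 := by gcongr
      _ ≤ 4 * ((∫⁻ x, (M x : ℝ≥0∞) ^ 2 ∂ν) * ∫⁻ x, h x ^ 2 ∂ν) := by
          rw [mul_pow, show (2 : ℝ≥0∞) ^ 2 = 4 by norm_num]
          gcongr
          exact sq_lintegral_mul_le hMm.coe_nnreal_ennreal.aemeasurable hh
      _ = _ := by ring

/-- The maximal inequality for the averages of `f` relative to the measure `σ dμ`. -/
theorem IsDualPair.exists_maximal_function {X : Type*} [MeasurableSpace X] {μ : Measure X}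
    {W σ : X → ℝ≥0∞} (h : IsDualPair μ W σ) {𝓖 : Finset (Set X)} (h𝓖 : IsLaminar 𝓖)
    (hm : ∀ A ∈ 𝓖, MeasurableSet A) (h0 : ∀ A ∈ 𝓖, μ A ≠ 0)
    (hσ : ∀ A ∈ 𝓖, ∫⁻ x in A, σ x ∂μ ≠ ∞) {f : X → ℝ≥0∞} (hf : AEMeasurable f μ)
    (hf2 : ∫⁻ x, f x ^ 2 * W x ∂μ ≠ ∞) :
    ∃ M : X → ℝ≥0∞, Measurable M ∧
      (∀ A ∈ 𝓖, ∀ x ∈ A, (∫⁻ y in A, f y ∂μ) / ∫⁻ y in A, σ y ∂μ ≤ M x) ∧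
      ∫⁻ x, M x ^ 2 * σ x ∂μ ≤ 4 * ∫⁻ x, f x ^ 2 * W x ∂μ := by
  have hac := withDensity_absolutelyContinuous μ σ
  have hfWμ : AEMeasurable (fun x => f x * W x) μ := hf.mul h.left
  have hfW := hfWμ.mono_ac hac
  -- Since `W σ = 1`, the quotient `∫_A f / σ(A)` is the average of `f W` relative to `σ dμ`, and
  -- the square norm of `f W` there is `∫ f² W`.
  have hint : ∀ A ∈ 𝓖, ∫⁻ x in A, f x * W x ∂(μ.withDensity σ) = ∫⁻ x in A, f x ∂μ := by
    intro A hA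
    rw [restrict_withDensity (hm A hA),
      lintegral_withDensity_eq_lintegral_mul₀ h.right.restrict hfWμ.restrict]
    refine lintegral_congr_ae ((h.restrict A).mul_eq_one.mono fun x hx => ?_)
    simp only [Pi.mul_apply]
    rw [mul_comm, mul_assoc, hx, mul_one]
  have hν : ∀ A ∈ 𝓖, (μ.withDensity σ) A = ∫⁻ x in A, σ x ∂μ := fun A hA =>
    withDensity_apply _ (hm A hA)
  obtain ⟨M, hM, hM1, hM2⟩ := h𝓖.exists_maximal_function (ν := μ.withDensity σ) hm
    (fun A hA => by rw [hν A hA]; exact hσ A hA)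
    (fun A hA => by rw [hν A hA]; exact h.symm.measure_pos_ne_zero (h0 A hA)) hfW
    (fun A hA => by rw [hint A hA]; exact h.setLIntegral_ne_top hf hf2 (hσ A hA))
  refine ⟨M, hM, fun A hA x hx => ?_, ?_⟩
  · rw [← hν A hA, ← hint A hA]; exact hM1 A hA x hx
  · rw [lintegral_withDensity_eq_lintegral_mul₀ h.right (hM.pow_const 2).aemeasurable,
      lintegral_withDensity_eq_lintegral_mul₀ h.right (hfWμ.pow_const 2)] at hM2
    calc ∫⁻ x, M x ^ 2 * σ x ∂μ = ∫⁻ x, (σ * fun x => M x ^ 2) x ∂μ :=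
          lintegral_congr fun x => mul_comm _ _
      _ ≤ _ := hM2
      _ = _ := by
          congr 1
          refine lintegral_congr_ae (h.mul_eq_one.mono fun x hx => ?_)
          simp only [Pi.mul_apply]
          calc σ x * (f x * W x) ^ 2 = f x ^ 2 * W x * (W x * σ x) := by ring
            _ = _ := by rw [hx, mul_one]

/-! ### The linear bound for sparse forms. -/

/-- The `A₂` bound, linear in the characteristic, for the bilinear form of a sparse family. -/
theorem IsDualPair.sq_sparse_form_le {X : Type*} [MeasurableSpace X] {μ : Measure X}
    {W σ : X → ℝ≥0∞} (h : IsDualPair μ W σ) {𝓖 : Finset (Set X)} (h𝓖 : IsFinSparse μ 𝓖)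
    (h0 : ∀ A ∈ 𝓖, μ A ≠ 0) (hfin : ∀ A ∈ 𝓖, μ A ≠ ∞)
    (hW : ∀ A ∈ 𝓖, ∫⁻ x in A, W x ∂μ ≠ ∞) (hσ : ∀ A ∈ 𝓖, ∫⁻ x in A, σ x ∂μ ≠ ∞)
    {a : ℝ≥0∞} (ha : ∀ A ∈ 𝓖, (∫⁻ x in A, W x ∂μ) * ∫⁻ x in A, σ x ∂μ ≤ a * μ A ^ 2)
    {f g : X → ℝ≥0∞} (hf : AEMeasurable f μ) (hg : AEMeasurable g μ)
    (hf2 : ∫⁻ x, f x ^ 2 * W x ∂μ ≠ ∞) (hg2 : ∫⁻ x, g x ^ 2 * σ x ∂μ ≠ ∞) :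
    (∑ A ∈ 𝓖, (∫⁻ x in A, f x ∂μ) / μ A * ∫⁻ x in A, g x ∂μ) ^ 2 ≤
      (8 * a) ^ 2 * ((∫⁻ x, f x ^ 2 * W x ∂μ) * ∫⁻ x, g x ^ 2 * σ x ∂μ) := by
  obtain ⟨M, hM, hM1, hM2⟩ := h.exists_maximal_function h𝓖.laminar h𝓖.measurableSet h0 hσ hf hf2
  obtain ⟨N, hN, hN1, hN2⟩ :=
    h.symm.exists_maximal_function h𝓖.laminar h𝓖.measurableSet h0 hW hg hg2
  have hterm : ∀ A ∈ 𝓖, (∫⁻ x in A, f x ∂μ) / μ A * ∫⁻ x in A, g x ∂μ ≤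
      2 * a * ∫⁻ x in ownPart 𝓖 A, M x * N x ∂μ := by
    intro A hA
    set w := ∫⁻ x in A, W x ∂μ with hw
    set s := ∫⁻ x in A, σ x ∂μ with hs
    have hw0 : w ≠ 0 := h.measure_pos_ne_zero (h0 A hA)
    have hs0 : s ≠ 0 := h.symm.measure_pos_ne_zero (h0 A hA)
    set u := (∫⁻ x in A, f x ∂μ) / s with hu
    set v := (∫⁻ x in A, g x ∂μ) / w with hv
    have hfu : ∫⁻ x in A, f x ∂μ = u * s := (ENNReal.div_mul_cancel hs0 (hσ A hA)).symm
    have hgv : ∫⁻ x in A, g x ∂μ = v * w := (ENNReal.div_mul_cancel hw0 (hW A hA)).symm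
    have hE : u * v * μ (ownPart 𝓖 A) ≤ ∫⁻ x in ownPart 𝓖 A, M x * N x ∂μ := by
      rw [← setLIntegral_const]
      refine setLIntegral_mono' (h𝓖.measurableSet_ownPart hA) fun x hx => ?_
      have hxA := ownPart_subset _ _ hx
      exact mul_le_mul' (hM1 A hA x hxA) (hN1 A hA x hxA)
    calc (∫⁻ x in A, f x ∂μ) / μ A * ∫⁻ x in A, g x ∂μ = u * v * (w * s) * (μ A)⁻¹ := by
          rw [hfu, hgv, div_eq_mul_inv]; ring
      _ ≤ u * v * (a * μ A ^ 2) * (μ A)⁻¹ := mul_le_mul' (mul_le_mul' le_rfl (ha A hA)) le_rfl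
      _ = a * (u * v) * μ A * (μ A * (μ A)⁻¹) := by ring
      _ = a * (u * v) * μ A := by rw [ENNReal.mul_inv_cancel (h0 A hA) (hfin A hA), mul_one]
      _ ≤ a * (u * v) * (2 * μ (ownPart 𝓖 A)) := by gcongr; exact h𝓖.measure_le hA (hfin A hA)
      _ = 2 * a * (u * v * μ (ownPart 𝓖 A)) := by ring
      _ ≤ _ := by gcongr
  have hsum : ∑ A ∈ 𝓖, (∫⁻ x in A, f x ∂μ) / μ A * ∫⁻ x in A, g x ∂μ ≤
      2 * a * ∫⁻ x, M x * N x ∂μ := by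
    refine (Finset.sum_le_sum hterm).trans ?_
    rw [← Finset.mul_sum, ← lintegral_biUnion_finset h𝓖.pairwiseDisjoint_ownPart
      fun A hA => h𝓖.measurableSet_ownPart hA]
    gcongr
    exact Measure.restrict_le_self
  calc _ ≤ (2 * a * ∫⁻ x, M x * N x ∂μ) ^ 2 := by gcongr
    _ = (2 * a) ^ 2 * (∫⁻ x, M x * N x ∂μ) ^ 2 := mul_pow _ _ _
    _ ≤ (2 * a) ^ 2 * ((∫⁻ x, M x ^ 2 * σ x ∂μ) * ∫⁻ x, N x ^ 2 * W x ∂μ) := by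
        gcongr
        exact h.symm.sq_lintegral_mul_le hM.aemeasurable hN.aemeasurable
    _ ≤ (2 * a) ^ 2 * ((4 * ∫⁻ x, f x ^ 2 * W x ∂μ) * (4 * ∫⁻ x, g x ^ 2 * σ x ∂μ)) := by gcongr
    _ = _ := by ring

/-! ### Pointwise sparse domination by a stopping time. -/

/-- If a packing condition and a counting condition hold for the sets `Q i ⊆ R i` and `L i`, the
operator `f ↦ ∑ i, ⟨f⟩_{R i} χ_{Q i}` is dominated pointwise by a sparse one. -/
theorem exists_sparse_domination {X ι : Type*} [MeasurableSpace X] {μ : Measure X}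
    {Q R L : ι → Set X} {m n c : ℕ} (hcm : 8 * c ≤ m) (hm : 0 < m) {f : X → ℝ≥0∞} (s : Finset ι)
    (hQR : ∀ i ∈ s, Q i ⊆ R i) (hR : ∀ i ∈ s, MeasurableSet (R i))
    (hL : ∀ i ∈ s, MeasurableSet (L i))
    (hlam : ∀ i ∈ s, ∀ j ∈ s, Disjoint (R i) (R j) ∨ R i ⊆ R j ∨ R j ⊆ R i)
    (h0 : ∀ i ∈ s, μ (R i) ≠ 0) (hfin : ∀ i ∈ s, μ (R i) ≠ ∞)
    (hf : ∀ i ∈ s, ∫⁻ x in R i, f x ∂μ ≠ ∞)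
    (hpack : ∀ t ⊆ s, ∀ F ∈ s, (∀ i ∈ t, R i ⊆ R F) → ∑ i ∈ t, μ (L i) ≤ 2 * c * μ (R F))
    (hcount : ∀ t ⊆ s, ∀ j ∈ s, ∀ x ∈ R j, (∀ i ∈ t, x ∈ Q i ∧ R j ⊆ R i ∧ ¬ R j ⊆ L i) →
      t.card ≤ n) :
    ∃ 𝓕 : Finset (Set X), (∀ A ∈ 𝓕, ∃ i ∈ s, A = R i) ∧ IsFinSparse μ 𝓕 ∧
      ∀ x, ∑ i ∈ s, (Q i).indicator (fun _ => (∫⁻ y in R i, f y ∂μ) / μ (R i)) x ≤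
        4 * (m + n : ℕ) * ∑ A ∈ 𝓕, A.indicator (fun _ => (∫⁻ y in A, f y ∂μ) / μ A) x := by
  classical
  induction s using Finset.strongInduction with
  | H s ih =>
    rcases s.eq_empty_or_nonempty with rfl | hne
    · exact ⟨∅, by simp, ⟨by simp, by simp [IsLaminar], by simp⟩, by simp⟩
    obtain ⟨F, hF, hmax⟩ := Finset.exists_maximalFor R s hne
    set sF := s.filter fun i => R i ⊆ R F
    set avg : Set X → ℝ≥0∞ := fun A => (∫⁻ y in A, f y ∂μ) / μ A with havg
    -- The two stopping rules below `F`: a large average, or too many sets `L j` containing `R i`.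
    -- The thresholds `4` and `m ≥ 8c` make each rule cover at most a quarter of `R F`.
    set tall := sF.filter fun i => 4 * avg (R F) < avg (R i)
    set deep := sF.filter fun i => m < (sF.filter fun j => R i ⊆ L j).card
    have hsFs : sF ⊆ s := Finset.filter_subset _ _
    have htallF : tall ⊆ sF := Finset.filter_subset _ _
    have hdeepF : deep ⊆ sF := Finset.filter_subset _ _
    have hsFF : ∀ i ∈ sF, R i ⊆ R F := fun i hi => (Finset.mem_filter.1 hi).2
    have hFF : F ∈ sF := Finset.mem_filter.2 ⟨hF, subset_rfl⟩
    have hlamI : ∀ t ⊆ s, IsLaminar (t.image R) := by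
      intro t ht A hA B hB
      obtain ⟨i, hi, rfl⟩ := Finset.mem_image.1 hA
      obtain ⟨j, hj, rfl⟩ := Finset.mem_image.1 hB
      exact hlam i (ht hi) j (ht hj)
    have hmI : ∀ t ⊆ s, ∀ A ∈ t.image R, MeasurableSet A := by
      intro t ht A hA
      obtain ⟨i, hi, rfl⟩ := Finset.mem_image.1 hA
      exact hR i (ht hi)
    have hUF : ∀ t ⊆ sF, (⋃ A ∈ t.image R, A) ⊆ R F := by
      intro t ht
      refine Set.iUnion₂_subset fun A hA => ?_
      obtain ⟨i, hi, rfl⟩ := Finset.mem_image.1 hA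
      exact hsFF i (ht hi)
    have hUm : ∀ t ⊆ s, MeasurableSet (⋃ A ∈ t.image R, A) := fun t ht =>
      Finset.measurableSet_biUnion _ (hmI t ht)
    have havgF : avg (R F) * μ (R F) = ∫⁻ y in R F, f y ∂μ :=
      ENNReal.div_mul_cancel (h0 F hF) (hfin F hF)
    have h_tall : 4 * μ (⋃ A ∈ tall.image R, A) ≤ μ (R F) := by
      rcases eq_or_ne (avg (R F)) 0 with hz | hz
      · have : tall = ∅ := by
          refine Finset.eq_empty_of_forall_notMem fun i hi => ?_
          have hlt := (Finset.mem_filter.1 hi).2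
          rw [hz, mul_zero] at hlt
          have : ∫⁻ y in R i, f y ∂μ ≤ ∫⁻ y in R F, f y ∂μ :=
            lintegral_mono_set (hsFF i (htallF hi))
          rw [← havgF, hz, zero_mul] at this
          simp [havg, le_antisymm this zero_le] at hlt
        simp [this]
      · have hzt : avg (R F) ≠ ∞ := ENNReal.div_ne_top (hf F hF) (h0 F hF)
        have h1 := (hlamI tall (htallF.trans hsFs)).mul_measure_biUnion_le (μ := μ)
          (ν := μ.withDensity f) (c := 4 * avg (R F)) (hmI _ (htallF.trans hsFs)) (by
            intro A hA
            obtain ⟨i, hi, rfl⟩ := Finset.mem_image.1 hA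
            rw [withDensity_apply _ (hR i (hsFs (htallF hi)))]
            exact ENNReal.mul_le_of_le_div (Finset.mem_filter.1 hi).2.le)
        rw [withDensity_apply _ (hUm _ (htallF.trans hsFs))] at h1
        have h2 : avg (R F) * (4 * μ (⋃ A ∈ tall.image R, A)) ≤ avg (R F) * μ (R F) := by
          calc _ = 4 * avg (R F) * μ (⋃ A ∈ tall.image R, A) := by ring
            _ ≤ _ := h1
            _ ≤ ∫⁻ y in R F, f y ∂μ := lintegral_mono_set (hUF tall htallF)
            _ = _ := havgF.symm
        exact (ENNReal.mul_le_mul_iff_right hz hzt).1 h2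
    have h_deep : 4 * μ (⋃ A ∈ deep.image R, A) ≤ μ (R F) := by
      -- Chebyshev for the overlap function of the sets `L j`: it is at least `m` on every deep set,
      -- and packing bounds its integral by `2c μ(R F)`.
      set N : X → ℝ≥0∞ := fun x => ∑ j ∈ sF, (L j).indicator (fun _ => 1) x with hN
      have h1 := (hlamI deep (hdeepF.trans hsFs)).mul_measure_biUnion_le (μ := μ)
        (ν := μ.withDensity N) (c := m) (hmI _ (hdeepF.trans hsFs)) (by
          intro A hA
          obtain ⟨i, hi, rfl⟩ := Finset.mem_image.1 hA
          have hRi := hR i (hsFs (hdeepF hi))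
          rw [withDensity_apply _ hRi, ← setLIntegral_const]
          refine setLIntegral_mono' hRi fun x hx => ?_
          have h2 := (Finset.mem_filter.1 hi).2.le
          calc (m : ℝ≥0∞) ≤ ((sF.filter fun j => R i ⊆ L j).card : ℝ≥0∞) := by exact_mod_cast h2
            _ = ∑ j ∈ sF.filter fun j => R i ⊆ L j, (L j).indicator (fun _ => (1 : ℝ≥0∞)) x := by
                rw [Finset.card_eq_sum_ones, Nat.cast_sum]
                refine Finset.sum_congr rfl fun j hj => ?_
                rw [Set.indicator_of_mem ((Finset.mem_filter.1 hj).2 hx)]; simp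
            _ ≤ N x := Finset.sum_le_sum_of_subset (Finset.filter_subset _ _))
      have h3 : (m : ℝ≥0∞) * μ (⋃ A ∈ deep.image R, A) ≤ 2 * c * μ (R F) := by
        refine h1.trans ?_
        rw [withDensity_apply _ (hUm _ (hdeepF.trans hsFs))]
        calc _ ≤ ∫⁻ x, N x ∂μ := setLIntegral_le_lintegral _ _
          _ = ∑ j ∈ sF, μ (L j) := by
              rw [hN, lintegral_finsetSum' _ fun j hj =>
                (measurable_const.indicator (hL j (hsFs hj))).aemeasurable]
              exact Finset.sum_congr rfl fun j hj => by
                rw [lintegral_indicator_const (hL j (hsFs hj)), one_mul]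
          _ ≤ _ := hpack sF hsFs F hF hsFF
      have h4 : (m : ℝ≥0∞) * (4 * μ (⋃ A ∈ deep.image R, A)) ≤ m * μ (R F) := by
        calc _ = 4 * ((m : ℝ≥0∞) * μ (⋃ A ∈ deep.image R, A)) := by ring
          _ ≤ 4 * (2 * c * μ (R F)) := by gcongr
          _ = ((8 * c : ℕ) : ℝ≥0∞) * μ (R F) := by push_cast; ring
          _ ≤ _ := by gcongr
      exact (ENNReal.mul_le_mul_iff_right (by exact_mod_cast hm.ne') (by simp)).1 h4
    set halted := tall ∪ deep with hhalted
    have h_halted : μ (⋃ A ∈ halted.image R, A) ≤ μ (R F) / 2 := by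
      have h1 : (⋃ A ∈ halted.image R, A) ⊆
          (⋃ A ∈ tall.image R, A) ∪ ⋃ A ∈ deep.image R, A := by
        rw [hhalted, Finset.image_union]
        simp only [Finset.mem_union]
        rintro x hx
        simp only [Set.mem_iUnion] at hx
        obtain ⟨A, hA | hA, hx⟩ := hx
        · exact Or.inl (Set.mem_biUnion hA hx)
        · exact Or.inr (Set.mem_biUnion hA hx)
      rw [ENNReal.le_div_iff_mul_le (by simp) (by simp)]
      have h2 : 2 * (μ (⋃ A ∈ halted.image R, A) * 2) ≤ 2 * μ (R F) := by
        calc _ = 4 * μ (⋃ A ∈ halted.image R, A) := by ring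
          _ ≤ 4 * (μ (⋃ A ∈ tall.image R, A) + μ (⋃ A ∈ deep.image R, A)) := by
              gcongr
              exact (measure_mono h1).trans (measure_union_le _ _)
          _ ≤ μ (R F) + μ (R F) := by rw [mul_add]; exact add_le_add h_tall h_deep
          _ = _ := (two_mul _).symm
      exact (ENNReal.mul_le_mul_iff_right (by simp) (by simp)).1 h2
    -- Indices below `F` but under no halted set. They are charged to the single set `R F`; the
    -- induction hypothesis handles all the others.
    set good := sF.filter fun i => ∀ j ∈ halted, ¬ R i ⊆ R j
    have hgoodF : good ⊆ sF := Finset.filter_subset _ _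
    have hFgood : F ∈ good := by
      refine Finset.mem_filter.2 ⟨hFF, fun j hj hFj => ?_⟩
      have h1 : μ (R F) ≤ μ (R F) / 2 := (measure_mono (hFj.trans
        (Set.subset_biUnion_of_mem (u := fun A : Set X => A)
          (Finset.mem_image_of_mem R hj)))).trans h_halted
      exact absurd h1 (not_le.2 (ENNReal.half_lt_self (h0 F hF) (hfin F hF)))
    have hss : s \ good ⊂ s := Finset.sdiff_ssubset (hgoodF.trans hsFs) ⟨F, hFgood⟩
    obtain ⟨𝓕, h𝓕, hsp, hdom⟩ := ih (s \ good) hss (fun i hi => hQR i (hss.1 hi))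
      (fun i hi => hR i (hss.1 hi)) (fun i hi => hL i (hss.1 hi))
      (fun i hi j hj => hlam i (hss.1 hi) j (hss.1 hj)) (fun i hi => h0 i (hss.1 hi))
      (fun i hi => hfin i (hss.1 hi)) (fun i hi => hf i (hss.1 hi))
      (fun t ht i hi => hpack t (ht.trans hss.1) i (hss.1 hi))
      (fun t ht j hj => hcount t (ht.trans hss.1) j (hss.1 hj))
    have h𝓕s : ∀ A ∈ 𝓕, ∃ i ∈ s, A = R i := fun A hA =>
      let ⟨i, hi, h⟩ := h𝓕 A hA; ⟨i, hss.1 hi, h⟩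
    -- Members of `𝓕` inside `R F` come from indices that are not good, hence lie under halted sets.
    -- This gives the half condition for the new member `R F`; maximality of `R F` preserves it for
    -- the old ones.
    have hin : ∀ A ∈ 𝓕, A ⊆ R F → A ⊆ ⋃ A ∈ halted.image R, A := by
      intro A hA hAF
      obtain ⟨i, hi, rfl⟩ := h𝓕 A hA
      rw [Finset.mem_sdiff] at hi
      have hisF : i ∈ sF := Finset.mem_filter.2 ⟨hi.1, hAF⟩
      have : ¬ ∀ j ∈ halted, ¬ R i ⊆ R j := fun h => hi.2 (Finset.mem_filter.2 ⟨hisF, h⟩)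
      push Not at this
      obtain ⟨j, hj, hij⟩ := this
      exact hij.trans (Set.subset_biUnion_of_mem (u := fun A : Set X => A)
        (Finset.mem_image_of_mem R hj))
    have hFnot : R F ∉ 𝓕 := fun h => by
      have h1 := (measure_mono (hin _ h subset_rfl)).trans h_halted
      exact absurd h1 (not_le.2 (ENNReal.half_lt_self (h0 F hF) (hfin F hF)))
    have hFmax : ∀ A ∈ 𝓕, ¬ R F ⊂ A := by
      intro A hA hFA
      obtain ⟨i, hi, rfl⟩ := h𝓕s A hA
      exact hFA.2 (hmax hi hFA.1)
    have hpt : ∀ x, ∑ i ∈ good, (Q i).indicator (fun _ => avg (R i)) x ≤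
        4 * (m + n : ℕ) * (R F).indicator (fun _ => avg (R F)) x := by
      intro x
      set gx := good.filter fun i => x ∈ Q i with hgx
      have hsum : ∑ i ∈ good, (Q i).indicator (fun _ => avg (R i)) x = ∑ i ∈ gx, avg (R i) := by
        rw [hgx, Finset.sum_filter (s := good) (p := fun i => x ∈ Q i)]
        exact Finset.sum_congr rfl fun i _ => by rw [Set.indicator_apply]
      rw [hsum]
      rcases gx.eq_empty_or_nonempty with hgx0 | hgxne
      · simp [hgx0]
      have hgxg : gx ⊆ good := Finset.filter_subset _ _
      have hgxR : ∀ i ∈ gx, x ∈ R i := fun i hi =>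
        hQR i (hsFs (hgoodF (hgxg hi))) (Finset.mem_filter.1 hi).2
      -- All `R i` with `i ∈ gx` contain `x`, so they form a chain with least element `R j`. The
      -- index `j` is not deep, which bounds the `i` with `R j ⊆ L i` by `m`; `hcount` bounds the
      -- rest by `n`.
      obtain ⟨j, hj, hjmin⟩ := Finset.exists_minimalFor R gx hgxne
      have hjall : ∀ i ∈ gx, R j ⊆ R i := by
        intro i hi
        rcases hlam i (hsFs (hgoodF (hgxg hi))) j (hsFs (hgoodF (hgxg hj))) with h | h | h
        · exact absurd (hgxR j hj) (Set.disjoint_left.1 h (hgxR i hi))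
        · exact hjmin hi h
        · exact h
      have hxF : x ∈ R F := hsFF j (hgoodF (hgxg hj)) (hgxR j hj)
      have hnothalt : ∀ i ∈ good, i ∉ halted := fun i hi h =>
        (Finset.mem_filter.1 hi).2 i h subset_rfl
      have havgle : ∀ i ∈ gx, avg (R i) ≤ 4 * avg (R F) := by
        intro i hi
        by_contra hlt
        exact hnothalt i (hgxg hi) (Finset.mem_union_left _
          (Finset.mem_filter.2 ⟨hgoodF (hgxg hi), not_le.1 hlt⟩))
      have hc1 : (gx.filter fun i => R j ⊆ L i).card ≤ m := by
        have h1 : (sF.filter fun i => R j ⊆ L i).card ≤ m := by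
          by_contra hlt
          exact hnothalt j (hgxg hj) (Finset.mem_union_right _
            (Finset.mem_filter.2 ⟨hgoodF (hgxg hj), not_le.1 hlt⟩))
        exact (Finset.card_le_card (Finset.filter_subset_filter _ (hgxg.trans hgoodF))).trans h1
      have hc2 : (gx.filter fun i => ¬ R j ⊆ L i).card ≤ n := by
        refine hcount _ ((Finset.filter_subset _ _).trans (hgxg.trans (hgoodF.trans hsFs))) j
          (hsFs (hgoodF (hgxg hj))) x (hgxR j hj) fun i hi => ?_
        rw [Finset.mem_filter] at hi
        exact ⟨(Finset.mem_filter.1 hi.1).2, hjall i hi.1, hi.2⟩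
      have hcard : gx.card ≤ m + n := by
        rw [← Finset.card_filter_add_card_filter_not (s := gx) fun i => R j ⊆ L i]
        exact add_le_add hc1 hc2
      calc ∑ i ∈ gx, avg (R i) ≤ gx.card • (4 * avg (R F)) := Finset.sum_le_card_nsmul _ _ _ havgle
        _ = gx.card * (4 * avg (R F)) := nsmul_eq_mul _ _
        _ ≤ (m + n : ℕ) * (4 * avg (R F)) := by gcongr
        _ = _ := by rw [Set.indicator_of_mem hxF]; ring
    refine ⟨insert (R F) 𝓕, ?_, ⟨?_, ?_, ?_⟩, fun x => ?_⟩
    · intro A hA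
      rcases Finset.mem_insert.1 hA with rfl | hA
      · exact ⟨F, hF, rfl⟩
      · exact h𝓕s A hA
    · intro A hA
      rcases Finset.mem_insert.1 hA with rfl | hA
      · exact hR F hF
      · exact hsp.measurableSet A hA
    · have : ∀ A ∈ insert (R F) 𝓕, ∃ i ∈ s, A = R i := by
        intro A hA
        rcases Finset.mem_insert.1 hA with rfl | hA
        · exact ⟨F, hF, rfl⟩
        · exact h𝓕s A hA
      intro A hA B hB
      obtain ⟨i, hi, rfl⟩ := this A hA
      obtain ⟨j, hj, rfl⟩ := this B hB
      exact hlam i hi j hj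
    · intro A hA
      rcases Finset.mem_insert.1 hA with rfl | hA
      · refine (measure_mono ?_).trans h_halted
        refine Set.iUnion₂_subset fun B hB => Set.iUnion_subset fun hBF => ?_
        rcases Finset.mem_insert.1 hB with rfl | hB
        · exact absurd rfl hBF.ne
        · exact hin B hB hBF.1
      · refine (measure_mono ?_).trans (hsp.half A hA)
        refine Set.iUnion₂_subset fun B hB => Set.iUnion_subset fun hBA => ?_
        rcases Finset.mem_insert.1 hB with rfl | hB
        · exact absurd hBA (hFmax A hA)
        · intro y hy
          simp only [Set.mem_iUnion]
          exact ⟨B, hB, hBA, hy⟩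
    · rw [Finset.sum_insert hFnot, mul_add, ← Finset.sum_sdiff (hgoodF.trans hsFs), add_comm]
      exact add_le_add (hpt x) (hdom x)

/-! ### Balls in a homogeneous space. -/

theorem iUnion_qBall {X : Type*} (ρ : X → X → ℝ) (x : X) :
    (⋃ n : ℕ, qBall ρ x (n + 1)) = Set.univ := by
  refine Set.eq_univ_of_forall fun y => Set.mem_iUnion.2 ?_
  obtain ⟨n, hn⟩ := exists_nat_gt (ρ x y)
  exact ⟨n, show ρ x y < n + 1 by linarith⟩

namespace IsHomogeneousSpace

variable {X : Type*} [MeasurableSpace X] {ρ : X → X → ℝ} {μ : Measure X} {C₀ Cd : ℝ}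

theorem mem_ball_self (hX : IsHomogeneousSpace ρ μ C₀ Cd) (x : X) {r : ℝ} (hr : 0 < r) :
    x ∈ qBall ρ x r := by
  change ρ x x < r
  rwa [(hX.eq_zero_iff x x).2 rfl]

theorem measure_ball_pos (hX : IsHomogeneousSpace ρ μ C₀ Cd) (x : X) {r : ℝ} (hr : 0 < r) :
    0 < μ (qBall ρ x r) := by
  simpa using hX.ball_pos x (r / 2) (by linarith) |>.trans_eq (by ring_nf)

/-- Positivity of the doubled ball forces `ENNReal.ofReal Cd` to be nonzero, so finiteness of its
product with the measure passes to the measure. -/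
theorem measure_ball_ne_top (hX : IsHomogeneousSpace ρ μ C₀ Cd) (x : X) {r : ℝ} (hr : 0 < r) :
    μ (qBall ρ x r) ≠ ∞ := by
  intro h
  have h1 := (hX.ball_pos x r hr).trans_le (hX.doubling x r hr)
  have h2 := hX.ball_lt_top x r hr
  rw [h, ENNReal.mul_top (pos_of_mul_pos_left h1 zero_le).ne'] at h2
  exact lt_irrefl _ h2

theorem measure_ball_two_pow_le (hX : IsHomogeneousSpace ρ μ C₀ Cd) (x : X) {r : ℝ} (hr : 0 < r)
    (j : ℕ) : μ (qBall ρ x (2 ^ j * r)) ≤ (⌈Cd⌉₊ : ℝ≥0∞) ^ j * μ (qBall ρ x r) := by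
  induction j with
  | zero => simp
  | succ j ih =>
    calc μ (qBall ρ x (2 ^ (j + 1) * r)) = μ (qBall ρ x (2 * (2 ^ j * r))) := by ring_nf
      _ ≤ ENNReal.ofReal Cd * μ (qBall ρ x (2 ^ j * r)) := hX.doubling _ _ (by positivity)
      _ ≤ ⌈Cd⌉₊ * ((⌈Cd⌉₊ : ℝ≥0∞) ^ j * μ (qBall ρ x r)) := by
          gcongr
          exact ENNReal.ofReal_le_of_le_toReal (by simpa using Nat.le_ceil Cd)
      _ = _ := by ring

theorem measure_ball_le (hX : IsHomogeneousSpace ρ μ C₀ Cd) (x : X) {r t : ℝ} (hr : 0 < r)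
    {j : ℕ} (hj : t ≤ 2 ^ j) :
    μ (qBall ρ x (t * r)) ≤ (⌈Cd⌉₊ : ℝ≥0∞) ^ j * μ (qBall ρ x r) := by
  refine (measure_mono fun y hy => ?_).trans (hX.measure_ball_two_pow_le x hr j)
  exact lt_of_lt_of_le (show ρ x y < t * r from hy) (by gcongr)

theorem sigmaFinite (hX : IsHomogeneousSpace ρ μ C₀ Cd) (x : X) : SigmaFinite μ :=
  ⟨⟨{ set := fun n : ℕ => qBall ρ x (n + 1)
      set_mem := fun _ => trivial
      finite := fun n => (hX.measure_ball_ne_top x (by positivity)).lt_top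
      spanning := iUnion_qBall ρ x }⟩⟩

end IsHomogeneousSpace

/-! ### Dyadic cubes. -/

namespace DyadicDecomposition

variable {X : Type*} [MeasurableSpace X] {ρ : X → X → ℝ} {μ : Measure X} {C₀ Cd C δ ε : ℝ}
  (S : DyadicDecomposition ρ μ C δ ε)

theorem center_mem (hX : IsHomogeneousSpace ρ μ C₀ Cd) (hδ : 0 < δ) {k : ℤ} {Q : Set X}
    (hQ : Q ∈ S.cubes k) : S.center k Q ∈ Q :=
  S.ball_subset k Q hQ (hX.mem_ball_self _ (zpow_pos hδ k))

theorem measure_cube_ne_zero (hX : IsHomogeneousSpace ρ μ C₀ Cd) (hδ : 0 < δ) {k : ℤ} {Q : Set X}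
    (hQ : Q ∈ S.cubes k) : μ Q ≠ 0 :=
  ((hX.measure_ball_pos _ (zpow_pos hδ k)).trans_le (measure_mono (S.ball_subset k Q hQ))).ne'

theorem measure_cube_ne_top (hX : IsHomogeneousSpace ρ μ C₀ Cd) (hC : 0 < C) (hδ : 0 < δ) {k : ℤ}
    {Q : Set X} (hQ : Q ∈ S.cubes k) : μ Q ≠ ∞ :=
  ne_top_of_le_ne_top (hX.measure_ball_ne_top _ (mul_pos hC (zpow_pos hδ k)))
    (measure_mono (S.subset_ball k Q hQ))

theorem measure_ball_le (hX : IsHomogeneousSpace ρ μ C₀ Cd) (hδ : 0 < δ) {k : ℤ}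
    {Q : Set X} (hQ : Q ∈ S.cubes k) {t : ℝ} {j : ℕ} (hj : t ≤ 2 ^ j) :
    μ (qBall ρ (S.center k Q) (t * δ ^ k)) ≤ (⌈Cd⌉₊ : ℝ≥0∞) ^ j * μ Q :=
  (hX.measure_ball_le _ (zpow_pos hδ k) hj).trans
    (mul_le_mul' le_rfl (measure_mono (S.ball_subset k Q hQ)))

/-- Cubes of the same level that share a point are equal. -/
theorem eq_of_mem {k : ℤ} {Q₁ Q₂ : Set X} (h₁ : Q₁ ∈ S.cubes k) (h₂ : Q₂ ∈ S.cubes k) {x : X}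
    (hx₁ : x ∈ Q₁) (hx₂ : x ∈ Q₂) : Q₁ = Q₂ := by
  have key : ∀ A ∈ S.cubes k, ∀ B ∈ S.cubes k, A ⊆ B → A = B := by
    intro A hA B hB hAB
    -- If `A ⊆ B` have the same level, a child of `A` has both as parents, so they coincide.
    obtain ⟨P, hP, hPA⟩ := S.exists_child k A hA
    have hu := S.existsUnique_parent (k + 1) P hP
    rw [add_sub_cancel_right] at hu
    exact hu.unique ⟨hA, hPA⟩ ⟨hB, hPA.trans hAB⟩
  rcases S.nested k k Q₁ h₁ Q₂ h₂ with h | h | h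
  · exact absurd hx₂ (Set.disjoint_left.1 h hx₁)
  · exact key _ h₁ _ h₂ h
  · exact (key _ h₂ _ h₁ h).symm

end DyadicDecomposition

/-! ### Sparse families of cubes. -/

namespace IsSparseFamily

variable {X : Type*} [MeasurableSpace X] {ρ : X → X → ℝ} {μ : Measure X} {C₀ Cd C δ ε : ℝ}
  {S : DyadicDecomposition ρ μ C δ ε} {q₀ : ℤ × Set X} {𝒞 : ℕ → Set (ℤ × Set X)}

theorem nonempty (hX : IsHomogeneousSpace ρ μ C₀ Cd) (hδ : 0 < δ) (h : IsSparseFamily S q₀ 𝒞)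
    {n : ℕ} {p : ℤ × Set X} (hp : p ∈ 𝒞 n) : p.2.Nonempty :=
  ⟨_, S.center_mem hX hδ (h.mem_cubes n p hp).1⟩

theorem exists_ancestor (h : IsSparseFamily S q₀ 𝒞) {m n : ℕ} (hmn : m ≤ n) {p : ℤ × Set X}
    (hp : p ∈ 𝒞 n) : ∃ q ∈ 𝒞 m, p.2 ⊆ q.2 := by
  induction n, hmn using Nat.le_induction generalizing p with
  | base => exact ⟨p, hp, subset_rfl⟩
  | succ n _ ih =>
    obtain ⟨q, hq, hpq⟩ := h.subset_prev n p hp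
    obtain ⟨r, hr, hqr⟩ := ih hq
    exact ⟨r, hr, hpq.trans hqr⟩

/-- Every later cube lies in a cube of generation `m + 1`, so the half condition for one generation
controls all later ones together. -/
theorem measure_later_le (h : IsSparseFamily S q₀ 𝒞) {m : ℕ} {q : ℤ × Set X} (hq : q ∈ 𝒞 m)
    {U : Set X} (hU : ∀ x ∈ U, x ∈ q.2 ∧ ∃ n, m < n ∧ ∃ p ∈ 𝒞 n, x ∈ p.2) :
    μ U ≤ μ q.2 / 2 := by
  refine (measure_mono fun x hx => ?_).trans (h.half m q hq)
  obtain ⟨hxq, n, hmn, p, hp, hxp⟩ := hU x hx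
  obtain ⟨r, hr, hpr⟩ := h.exists_ancestor hmn hp
  exact ⟨Set.mem_biUnion hr (hpr hxp), hxq⟩

/-- A set repeated in a later generation would have at most half of its own positive finite measure.
Hence sums over pairs (level, set) are sums over sets, as Carleson packing needs. -/
theorem eq_of_set_eq (hX : IsHomogeneousSpace ρ μ C₀ Cd) (hC : 0 < C) (hδ : 0 < δ)
    (h : IsSparseFamily S q₀ 𝒞) {m n : ℕ} {p q : ℤ × Set X} (hp : p ∈ 𝒞 m) (hq : q ∈ 𝒞 n)
    (hpq : p.2 = q.2) : p = q := by
  have key : ∀ m n (p q : ℤ × Set X), p ∈ 𝒞 m → q ∈ 𝒞 n → p.2 = q.2 → ¬ m < n := by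
    intro m n p q hp hq hpq hmn
    have h1 : μ p.2 ≤ μ p.2 / 2 := h.measure_later_le hp fun x hx =>
      ⟨hx, n, hmn, q, hq, hpq ▸ hx⟩
    have hpc := (h.mem_cubes m p hp).1
    exact absurd h1 (not_le.2 (ENNReal.half_lt_self (S.measure_cube_ne_zero hX hδ hpc)
      (S.measure_cube_ne_top hX hC hδ hpc)))
  obtain rfl : m = n := le_antisymm (not_lt.1 (key n m q p hq hp hpq.symm))
    (not_lt.1 (key m n p q hp hq hpq))
  by_contra hne
  obtain ⟨x, hx⟩ := h.nonempty hX hδ hp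
  exact Set.disjoint_left.1 (h.disjoint m p hp q hq hne) hx (hpq ▸ hx)

theorem injOn (hX : IsHomogeneousSpace ρ μ C₀ Cd) (hC : 0 < C) (hδ : 0 < δ)
    (h : IsSparseFamily S q₀ 𝒞) : Set.InjOn Prod.snd (⋃ n, 𝒞 n) := by
  intro p hp q hq hpq
  obtain ⟨m, hp⟩ := Set.mem_iUnion.1 hp
  obtain ⟨n, hq⟩ := Set.mem_iUnion.1 hq
  exact h.eq_of_set_eq hX hC hδ hp hq hpq

theorem isFinSparse [DecidableEq (Set X)] (h : IsSparseFamily S q₀ 𝒞)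
    (s : Finset (ℤ × Set X)) (hs : ↑s ⊆ ⋃ n, 𝒞 n) :
    IsFinSparse μ (s.image Prod.snd) := by
  have hmem : ∀ A ∈ s.image Prod.snd, ∃ n, ∃ p ∈ 𝒞 n, p.2 = A := by
    intro A hA
    obtain ⟨p, hp, rfl⟩ := Finset.mem_image.1 hA
    obtain ⟨n, hn⟩ := Set.mem_iUnion.1 (hs hp)
    exact ⟨n, p, hn, rfl⟩
  refine ⟨?_, ?_, ?_⟩
  · intro A hA
    obtain ⟨n, p, hp, rfl⟩ := hmem A hA
    exact S.measurableSet_cube _ _ (h.mem_cubes n p hp).1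
  · intro A hA B hB
    obtain ⟨n, p, hp, rfl⟩ := hmem A hA
    obtain ⟨m, q, hq, rfl⟩ := hmem B hB
    exact S.nested _ _ _ (h.mem_cubes n p hp).1 _ (h.mem_cubes m q hq).1
  · intro A hA
    obtain ⟨m, q, hq, rfl⟩ := hmem A hA
    refine h.measure_later_le hq fun x hx => ?_
    simp only [Set.mem_iUnion] at hx
    obtain ⟨B, hB, hBq, hxB⟩ := hx
    obtain ⟨n, p, hp, rfl⟩ := hmem B hB
    refine ⟨hBq.1 hxB, n, ?_, p, hp, hxB⟩
    -- If `p` were not of a later generation than `q`, the ancestor of `q` in the generation of `p`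
    -- would meet `p`, hence equal it, and `q` would lie inside its proper subset.
    by_contra hnm
    obtain ⟨r, hr, hqr⟩ := h.exists_ancestor (not_lt.1 hnm) hq
    have : r = p := by
      by_contra hne
      exact Set.disjoint_left.1 (h.disjoint n r hr p hp hne) (hqr (hBq.1 hxB)) hxB
    exact hBq.2 (this ▸ hqr)

/-- Each generation consists of disjoint sets of positive measure in a σ-finite space. Countability
is what later permits monotone convergence. -/
theorem countable (hX : IsHomogeneousSpace ρ μ C₀ Cd) (hδ : 0 < δ)
    (h : IsSparseFamily S q₀ 𝒞) : (⋃ n, 𝒞 n).Countable := by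
  refine Set.countable_iUnion fun n => ?_
  rcases (𝒞 n).eq_empty_or_nonempty with he | ⟨p₀, hp₀⟩
  · simp [he]
  have := hX.sigmaFinite (S.center p₀.1 p₀.2)
  have h1 := Measure.countable_meas_pos_of_disjoint_iUnion (μ := μ)
    (As := fun p : 𝒞 n => p.1.2)
    (fun p => S.measurableSet_cube _ _ (h.mem_cubes n p.1 p.2).1)
    (fun p q hne => h.disjoint n p.1 p.2 q.1 q.2 fun e => hne (Subtype.ext e))
  have h2 : {p : 𝒞 n | 0 < μ p.1.2} = Set.univ := Set.eq_univ_of_forall fun p =>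
    pos_iff_ne_zero.2 (S.measure_cube_ne_zero hX hδ (h.mem_cubes n p.1 p.2).1)
  rw [h2, Set.countable_univ_iff] at h1
  exact Set.countable_coe_iff.1 h1

end IsSparseFamily

/-! ### `A₂` weights on balls and cubes. -/

namespace IsA2Weight

variable {X : Type*} [MeasurableSpace X] {ρ : X → X → ℝ} {μ : Measure X} {C₀ Cd : ℝ} {w : X → ℝ}

/-- Measurability of `w` comes from its integrability on the balls about `x`, which exhaust `X`. -/
theorem isDualPair (x : X) (hw : IsA2Weight ρ μ w) :
    IsDualPair μ (fun x => ENNReal.ofReal (w x)) fun x => (ENNReal.ofReal (w x))⁻¹ := by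
  have hm : AEMeasurable w μ := by
    rw [← Measure.restrict_univ (μ := μ), ← iUnion_qBall ρ x,
      aemeasurable_iUnion_iff]
    exact fun n => (hw.integrableOn_ball x (n + 1) (by positivity)).1.aemeasurable
  refine ⟨hm.ennreal_ofReal, hm.ennreal_ofReal.inv, hw.ae_pos.mono fun y hy => ?_⟩
  exact ENNReal.mul_inv_cancel (by simpa using hy) ENNReal.ofReal_ne_top

theorem mul_le (hX : IsHomogeneousSpace ρ μ C₀ Cd) (x : X) {r : ℝ} (hr : 0 < r) :
    (∫⁻ y in qBall ρ x r, ENNReal.ofReal (w y) ∂μ) *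
      ∫⁻ y in qBall ρ x r, (ENNReal.ofReal (w y))⁻¹ ∂μ ≤
      a2Char ρ μ w * μ (qBall ρ x r) ^ 2 := by
  have h1 : ((∫⁻ y in qBall ρ x r, ENNReal.ofReal (w y) ∂μ) / μ (qBall ρ x r)) *
      ((∫⁻ y in qBall ρ x r, (ENNReal.ofReal (w y))⁻¹ ∂μ) / μ (qBall ρ x r)) ≤ a2Char ρ μ w :=
    le_iSup₂_of_le x r (le_iSup_of_le hr le_rfl)
  have h0 := (hX.measure_ball_pos x hr).ne'
  have ht := hX.measure_ball_ne_top x hr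
  calc _ = ((∫⁻ y in qBall ρ x r, ENNReal.ofReal (w y) ∂μ) / μ (qBall ρ x r) *
        μ (qBall ρ x r)) * ((∫⁻ y in qBall ρ x r, (ENNReal.ofReal (w y))⁻¹ ∂μ) /
        μ (qBall ρ x r) * μ (qBall ρ x r)) := by
        rw [ENNReal.div_mul_cancel h0 ht, ENNReal.div_mul_cancel h0 ht]
    _ = _ * μ (qBall ρ x r) ^ 2 := by rw [mul_mul_mul_comm, ← sq]
    _ ≤ _ := by gcongr

theorem lintegral_ball_ne_top (hw : IsA2Weight ρ μ w) (x : X) {r : ℝ} (hr : 0 < r) :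
    ∫⁻ y in qBall ρ x r, ENNReal.ofReal (w y) ∂μ ≠ ∞ := by
  have := (hw.integrableOn_ball x r hr).hasFiniteIntegral
  rw [hasFiniteIntegral_iff_ofReal (ae_of_all _ hw.nonneg)] at this
  exact this.ne

/-- The `w`-mass of a ball is positive, so an infinite mass of `w⁻¹` would make the `A₂` product
infinite. -/
theorem lintegral_inv_ball_ne_top (hX : IsHomogeneousSpace ρ μ C₀ Cd) (hw : IsA2Weight ρ μ w)
    (x : X) {r : ℝ} (hr : 0 < r) : ∫⁻ y in qBall ρ x r, (ENNReal.ofReal (w y))⁻¹ ∂μ ≠ ∞ := by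
  intro h
  have h1 := mul_le (w := w) hX x hr
  rw [h, ENNReal.mul_top ((hw.isDualPair x).measure_pos_ne_zero
    (hX.measure_ball_pos x hr).ne')] at h1
  exact absurd h1 (not_le.2 (ENNReal.mul_lt_top hw.a2Char_lt_top
    (ENNReal.pow_lt_top (hX.measure_ball_ne_top x hr).lt_top)))

/-- A cube lies between two concentric balls of comparable measure; the doubling loss enters
squared. -/
theorem mul_cube_le (hX : IsHomogeneousSpace ρ μ C₀ Cd) {C δ ε : ℝ} (hC : 0 < C) (hδ : 0 < δ)
    (T : DyadicDecomposition ρ μ C δ ε) {m : ℤ} {A : Set X} (hA : A ∈ T.cubes m) {j : ℕ}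
    (hj : C ≤ 2 ^ j) :
    (∫⁻ y in A, ENNReal.ofReal (w y) ∂μ) * ∫⁻ y in A, (ENNReal.ofReal (w y))⁻¹ ∂μ ≤
      ((⌈Cd⌉₊ : ℝ≥0∞) ^ (2 * j) * a2Char ρ μ w) * μ A ^ 2 := by
  have hsub := T.subset_ball m A hA
  calc _ ≤ _ := mul_le_mul' (lintegral_mono_set hsub) (lintegral_mono_set hsub)
    _ ≤ a2Char ρ μ w * μ (qBall ρ (T.center m A) (C * δ ^ m)) ^ 2 :=
        mul_le hX _ (mul_pos hC (zpow_pos hδ m))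
    _ ≤ a2Char ρ μ w * ((⌈Cd⌉₊ : ℝ≥0∞) ^ j * μ A) ^ 2 := by
        gcongr; exact T.measure_ball_le hX hδ hA hj
    _ = _ := by rw [mul_pow, ← pow_mul, mul_comm j 2]; ring

end IsA2Weight

/-! ### From bilinear forms to norms of series. -/

theorem ENNReal.iSup_sq {ι : Type*} (f : ι → ℝ≥0∞) : (⨆ i, f i) ^ 2 = ⨆ i, f i ^ 2 := by
  have := (ENNReal.orderIsoRpow 2 (by norm_num)).map_iSup f
  simp only [ENNReal.orderIsoRpow_apply, ENNReal.rpow_two] at this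
  exact this

theorem lintegral_sum_indicator_mul {X ι : Type*} [MeasurableSpace X] {μ : Measure X}
    {s : Finset ι} {P : ι → Set X} {c : ι → ℝ≥0∞} (hP : ∀ i ∈ s, MeasurableSet (P i))
    {g : X → ℝ≥0∞} (hg : AEMeasurable g μ) :
    ∫⁻ x, (∑ i ∈ s, (P i).indicator (fun _ => c i) x) * g x ∂μ =
      ∑ i ∈ s, c i * ∫⁻ x in P i, g x ∂μ := by
  simp only [Finset.sum_mul]
  rw [lintegral_finsetSum' s (f := fun i x => (P i).indicator (fun _ => c i) x * g x)
    fun i hi => (measurable_const.indicator (hP i hi)).aemeasurable.mul hg]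
  refine Finset.sum_congr rfl fun i hi => ?_
  rw [← lintegral_const_mul'' _ hg.restrict, ← lintegral_indicator (hP i hi)]
  refine lintegral_congr fun x => ?_
  by_cases hx : x ∈ P i <;> simp [hx]

namespace IsDualPair

variable {X ι : Type*} [MeasurableSpace X] {μ : Measure X} {W σ : X → ℝ≥0∞}

/-- Duality: testing a step function against `L²(σ)` bounds its norm in `L²(W)`. -/
theorem lintegral_sq_sum_indicator_le (h : IsDualPair μ W σ) {s : Finset ι} {P : ι → Set X}
    {c : ι → ℝ≥0∞} (hP : ∀ i ∈ s, MeasurableSet (P i)) (hc : ∀ i ∈ s, c i ≠ ∞)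
    (hW : ∀ i ∈ s, ∫⁻ x in P i, W x ∂μ ≠ ∞) {N : ℝ≥0∞}
    (H : ∀ g : X → ℝ≥0∞, AEMeasurable g μ → ∫⁻ x, g x ^ 2 * σ x ∂μ ≠ ∞ →
      (∑ i ∈ s, c i * ∫⁻ x in P i, g x ∂μ) ^ 2 ≤ N * ∫⁻ x, g x ^ 2 * σ x ∂μ) :
    ∫⁻ x, (∑ i ∈ s, (P i).indicator (fun _ => c i) x) ^ 2 * W x ∂μ ≤ N := by
  set u : X → ℝ≥0∞ := fun x => ∑ i ∈ s, (P i).indicator (fun _ => c i) x with hu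
  have hum : Measurable u := Finset.measurable_fun_sum _ fun i hi =>
    measurable_const.indicator (hP i hi)
  have hint : ∀ g : X → ℝ≥0∞, AEMeasurable g μ →
      ∫⁻ x, u x * g x ∂μ = ∑ i ∈ s, c i * ∫⁻ x in P i, g x ∂μ :=
    fun g hg => lintegral_sum_indicator_mul hP hg
  have hule : ∀ x, u x ≤ ∑ i ∈ s, c i := fun x =>
    Finset.sum_le_sum fun i _ => Set.indicator_le_self' (fun _ _ => zero_le) x
  have hfin : ∫⁻ x, u x ^ 2 * W x ∂μ ≠ ∞ := by
    refine ne_top_of_le_ne_top ?_ (lintegral_mono (g := fun x => (∑ i ∈ s, c i) * (u x * W x))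
      fun x => ?_)
    · rw [lintegral_const_mul' _ _ (ENNReal.sum_ne_top.2 hc), hint W h.left]
      exact ENNReal.mul_ne_top (ENNReal.sum_ne_top.2 hc)
        (ENNReal.sum_ne_top.2 fun i hi => ENNReal.mul_ne_top (hc i hi) (hW i hi))
    · simp only
      rw [sq, mul_assoc]
      exact mul_le_mul' (hule x) le_rfl
  -- The extremal test function is `g = u W`: both its pairing with `u` and its square norm in
  -- `L²(σ)` equal `∫ u² W`.
  have h1 : ∫⁻ x, (u x * W x) ^ 2 * σ x ∂μ = ∫⁻ x, u x ^ 2 * W x ∂μ := by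
    refine lintegral_congr_ae (h.mul_eq_one.mono fun x hx => ?_)
    calc (u x * W x) ^ 2 * σ x = u x ^ 2 * W x * (W x * σ x) := by ring
      _ = _ := by rw [hx, mul_one]
  have h2 : ∫⁻ x, u x * (u x * W x) ∂μ = ∫⁻ x, u x ^ 2 * W x ∂μ :=
    lintegral_congr fun x => by ring
  have huW : AEMeasurable (fun x => u x * W x) μ := hum.aemeasurable.mul h.left
  have h3 := H _ huW (by rwa [h1])
  rw [← hint _ huW, h1, h2] at h3
  simpa using ENNReal.le_mul_of_sq_le_mul (c := N) (b := 1) hfin (by simpa using h3)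

/-- Monotone convergence for bounds of sums in `L²(W)`. -/
theorem lintegral_sq_tsum_le [Countable ι] (h : IsDualPair μ W σ) {v : ι → X → ℝ≥0∞}
    (hv : ∀ i, Measurable (v i)) {N : ℝ≥0∞}
    (H : ∀ s : Finset ι, ∫⁻ x, (∑ i ∈ s, v i x) ^ 2 * W x ∂μ ≤ N) :
    ∫⁻ x, (∑' i, v i x) ^ 2 * W x ∂μ ≤ N := by
  simp only [ENNReal.tsum_eq_iSup_sum, ENNReal.iSup_sq, ENNReal.iSup_mul]
  rw [lintegral_iSup_directed]
  · exact iSup_le H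
  · exact fun s => ((Finset.measurable_fun_sum s fun i _ => hv i).pow_const 2).aemeasurable.mul
      h.left
  · refine Monotone.directed_le fun s t hst x => ?_
    simp only
    gcongr

end IsDualPair

theorem eLpNorm_weighted_sq {X : Type*} [MeasurableSpace X] {μ : Measure X} {w : X → ℝ}
    (hw : AEMeasurable (fun x => ENNReal.ofReal (w x)) μ) {f : X → ℝ}
    (hf : AEStronglyMeasurable f μ) :
    eLpNorm f 2 (weighted μ w) ^ 2 = ∫⁻ x, ‖f x‖ₑ ^ 2 * ENNReal.ofReal (w x) ∂μ := by
  rw [eLpNorm_eq_lintegral_rpow_enorm_toReal (by norm_num) (by norm_num), ← ENNReal.rpow_natCast,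
    ← ENNReal.rpow_mul]
  norm_num
  rw [weighted, lintegral_withDensity_eq_lintegral_mul₀ hw (hf.enorm.pow_const 2)]
  exact lintegral_congr fun x => mul_comm (ENNReal.ofReal (w x)) _

/-- A series of functions that is dominated in `L²(W)` converges to an element of `L²(W)`. -/
theorem memLp_tsum_of_lintegral_le {X ι : Type*} [MeasurableSpace X] [Countable ι] {μ : Measure X}
    {w : X → ℝ} {σ : X → ℝ≥0∞} (h : IsDualPair μ (fun x => ENNReal.ofReal (w x)) σ)
    {u : ι → X → ℝ} (hu : ∀ i, Measurable (u i)) {v : ι → X → ℝ≥0∞} (hv : ∀ i, Measurable (v i))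
    (huv : ∀ i x, ‖u i x‖ₑ ≤ v i x) {N : ℝ≥0∞} (hN : N ≠ ∞)
    (H : ∫⁻ x, (∑' i, v i x) ^ 2 * ENNReal.ofReal (w x) ∂μ ≤ N ^ 2) :
    (∀ᵐ x ∂μ, Summable fun i => u i x) ∧ MemLp (fun x => ∑' i, u i x) 2 (weighted μ w) ∧
      eLpNorm (fun x => ∑' i, u i x) 2 (weighted μ w) ≤ N := by
  have hlt : ∀ᵐ x ∂μ, (∑' i, v i x) ^ 2 * ENNReal.ofReal (w x) < ∞ :=
    ae_lt_top' (((Measurable.tsum hv).pow_const 2).aemeasurable.mul h.left)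
      (ne_top_of_le_ne_top (ENNReal.pow_ne_top hN) H)
  have hsum : ∀ᵐ x ∂μ, Summable fun i => u i x := by
    filter_upwards [hlt, h.mul_eq_one] with x hx hx1
    have hw0 : ENNReal.ofReal (w x) ≠ 0 := fun h0 => by simp [h0] at hx1
    have hvx : ∑' i, v i x ≠ ∞ := fun h0 => by
      rw [h0] at hx
      simp [ENNReal.top_mul hw0] at hx
    have h1 : ∑' i, ‖u i x‖ₑ ≠ ∞ := ne_top_of_le_ne_top hvx (ENNReal.tsum_le_tsum fun i => huv i x)
    refine Summable.of_norm ?_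
    have h2 := ENNReal.tsum_coe_ne_top_iff_summable.1 h1
    exact NNReal.summable_coe.2 h2
  have hm : AEStronglyMeasurable (fun x => ∑' i, u i x) μ :=
    aestronglyMeasurable_of_tendsto_ae Filter.atTop (f := fun (s : Finset ι) x => ∑ i ∈ s, u i x)
      (fun s => (Finset.measurable_fun_sum s fun i _ => hu i).aestronglyMeasurable)
      (hsum.mono fun x hx => hx.hasSum)
  have hle : eLpNorm (fun x => ∑' i, u i x) 2 (weighted μ w) ≤ N := by
    rw [← ENNReal.pow_le_pow_left_iff two_ne_zero, eLpNorm_weighted_sq h.left hm]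
    refine (lintegral_mono fun x => ?_).trans H
    gcongr
    exact (enorm_tsum_le_tsum_enorm).trans (ENNReal.tsum_le_tsum fun i => huv i x)
  exact ⟨hsum, ⟨hm.mono_ac (withDensity_absolutelyContinuous _ _), hle.trans_lt hN.lt_top⟩, hle⟩

/-! ### The discrete operators. -/

namespace DiscreteOperator

variable {X : Type*} [MeasurableSpace X] {ρ : X → X → ℝ} {μ : Measure X}
  {C₀ Cd C δ ε C' δ' ε' : ℝ} {S : DyadicDecomposition ρ μ C δ ε}
  {T : DyadicDecomposition ρ μ C' δ' ε'} {D : ℝ} {k : ℕ}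

theorem mem_cubes (B : DiscreteOperator S T D k) {p : ℤ × Set X} (hp : p ∈ B.family) :
    p.2 ∈ S.cubes p.1 := by
  obtain ⟨n, hn⟩ := Set.mem_iUnion.1 (B.family_subset hp)
  exact (B.sparse.mem_cubes n p hn).1

theorem countable_family (hX : IsHomogeneousSpace ρ μ C₀ Cd) (hδ : 0 < δ)
    (B : DiscreteOperator S T D k) : Countable B.family :=
  ((B.sparse.countable hX hδ).mono B.family_subset).to_subtype

theorem subset_star (hC : 0 < C) (hδ : 0 < δ) (B : DiscreteOperator S T D k) {p : ℤ × Set X}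
    (hp : p ∈ B.family) : p.2 ⊆ B.star p := by
  refine (S.subset_ball _ _ (B.mem_cubes hp)).trans
    (Set.Subset.trans (fun y hy => ?_) (B.dilate_subset_star p hp))
  have h1 : (1 : ℝ) ≤ 2 ^ k := one_le_pow₀ (by norm_num)
  have h2 : 0 < C * δ ^ p.1 := mul_pos hC (zpow_pos hδ _)
  refine lt_of_lt_of_le (show ρ _ y < C * δ ^ p.1 from hy) ?_
  nlinarith

/-- Cubes `Q ∋ x` with `A ⊆ Q^*` that are too small for a fixed dilate to contain `A` occupy at
most `a k` levels. -/
theorem card_le (hX : IsHomogeneousSpace ρ μ C₀ Cd) (hC : 0 < C) (hδ : 0 < δ) (hδ1 : δ < 1)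
    (hD : 0 < D) {a : ℕ} (ha : δ ^ a ≤ (2 * (D * C + 1))⁻¹) (hk : 1 ≤ k)
    (B : DiscreteOperator S T D k) (t : Finset (ℤ × Set X)) (ht : ↑t ⊆ B.family) {A : Set X}
    {x : X} (hxA : x ∈ A) (h : ∀ p ∈ t, x ∈ p.2 ∧ A ⊆ B.star p ∧
      ¬ A ⊆ qBall ρ (S.center p.1 p.2) (C₀ * (C + 1) * δ ^ p.1)) :
    t.card ≤ a * k := by
  have hscale : ∀ p ∈ t, ∀ q ∈ t, q.1 < p.1 + a * k := by
    intro p hp q hq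
    obtain ⟨hxp, hAp, hp'⟩ := h p hp
    obtain ⟨y, hyA, hy⟩ := Set.not_subset.1 hp'
    have hy : C₀ * (C + 1) * δ ^ p.1 ≤ ρ (S.center p.1 p.2) y := not_lt.1 hy
    have h1 : ρ (S.center p.1 p.2) x < C * δ ^ p.1 :=
      S.subset_ball _ _ (B.mem_cubes (ht hp)) hxp
    have h2 := hX.triangle (S.center p.1 p.2) x y
    have h3 : (C + 1) * δ ^ p.1 ≤ ρ (S.center p.1 p.2) x + ρ x y := by
      refine le_of_mul_le_mul_left ?_ hX.C₀_pos
      rw [← mul_assoc]; exact hy.trans h2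
    -- The `+ 1` in the radius `C₀ (C + 1) δ^{p.1}` leaves this margin once the distance from the
    -- center to `x`, less than `C δ^{p.1}`, is subtracted.
    have h4 : δ ^ p.1 < ρ x y := by linarith
    have h5 := B.diam_star q (ht hq) x ((h q hq).2.1 hxA) y ((h q hq).2.1 hyA)
    -- The choice of `a` makes `a` levels absorb one factor `2` of the dilation and one factor `D C
    -- + 1`, so `a k` levels absorb `2^k D C`.
    have h6 : δ ^ (a * k) * (D * (2 ^ k * C)) ≤ 1 := by
      have hDC : 0 < D * C := mul_pos hD hC
      calc δ ^ (a * k) * (D * (2 ^ k * C)) = (δ ^ a) ^ k * (2 ^ k * (D * C)) := by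
            rw [pow_mul]; ring
        _ ≤ ((2 * (D * C + 1))⁻¹) ^ k * (2 ^ k * (D * C + 1) ^ k) := by
            gcongr
            exact (by linarith : D * C ≤ D * C + 1).trans
              (le_self_pow₀ (by linarith) (by omega))
        _ = 1 := by rw [← mul_pow, ← mul_pow, inv_mul_cancel₀ (by positivity), one_pow]
    have h7 : δ ^ (p.1 + a * k) < δ ^ q.1 := by
      rw [zpow_add₀ hδ.ne', show ((a : ℤ) * k) = ((a * k : ℕ) : ℤ) by push_cast; rfl, zpow_natCast]
      calc δ ^ p.1 * δ ^ (a * k) < D * (2 ^ k * C * δ ^ q.1) * δ ^ (a * k) := by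
            gcongr; exact h4.trans_le h5
        _ = δ ^ (a * k) * (D * (2 ^ k * C)) * δ ^ q.1 := by ring
        _ ≤ 1 * δ ^ q.1 := by gcongr
        _ = _ := one_mul _
    exact (zpow_lt_zpow_iff_right_of_lt_one₀ hδ hδ1).1 h7
  rcases t.eq_empty_or_nonempty with rfl | hne
  · simp
  -- Cubes through `x` are determined by their levels, which lie in an interval of length `a k`.
  obtain ⟨p₀, hp₀, hmin⟩ := Finset.exists_min_image t Prod.fst hne
  calc t.card ≤ (Finset.Ico p₀.1 (p₀.1 + (a * k : ℕ))).card := by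
        refine Finset.card_le_card_of_injOn Prod.fst (fun p hp => ?_) fun p hp q hq hpq => ?_
        · have := hscale p₀ hp₀ p hp
          simp only [Finset.coe_Ico, Set.mem_Ico]
          exact ⟨hmin p hp, by push_cast; exact this⟩
        · refine Prod.ext hpq (S.eq_of_mem (B.mem_cubes (ht hp)) ?_ (h p hp).1 (h q hq).1)
          have := B.mem_cubes (ht hq)
          rwa [← hpq] at this
    _ = a * k := by rw [Int.card_Ico, add_sub_cancel_left, Int.toNat_natCast]

/-- The bilinear form of a finite part of a discrete operator obeys the linear `A₂` bound. -/
theorem sq_form_le (hX : IsHomogeneousSpace ρ μ C₀ Cd) (hC : 0 < C) (hδ : 0 < δ) (hδ1 : δ < 1)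
    (hC' : 0 < C') (hδ' : 0 < δ') (hD : 0 < D) {a j : ℕ} (ha : δ ^ a ≤ (2 * (D * C + 1))⁻¹)
    (hj : C₀ * (C + 1) ≤ 2 ^ j) (hk : 1 ≤ k) (B : DiscreteOperator S T D k)
    {W σ : X → ℝ≥0∞} (h : IsDualPair μ W σ)
    (hW : ∀ p ∈ B.family, ∫⁻ x in B.star p, W x ∂μ ≠ ∞)
    (hσ : ∀ p ∈ B.family, ∫⁻ x in B.star p, σ x ∂μ ≠ ∞) {b : ℝ≥0∞}
    (hb : ∀ p ∈ B.family,
      (∫⁻ x in B.star p, W x ∂μ) * ∫⁻ x in B.star p, σ x ∂μ ≤ b * μ (B.star p) ^ 2)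
    (s : Finset (ℤ × Set X)) (hs : ↑s ⊆ B.family) {f g : X → ℝ≥0∞} (hf : AEMeasurable f μ)
    (hg : AEMeasurable g μ) (hf2 : ∫⁻ x, f x ^ 2 * W x ∂μ ≠ ∞)
    (hg2 : ∫⁻ x, g x ^ 2 * σ x ∂μ ≠ ∞) :
    (∑ p ∈ s, (∫⁻ x in B.star p, f x ∂μ) / μ (B.star p) * ∫⁻ x in p.2, g x ∂μ) ^ 2 ≤
      (32 * ((8 * ⌈Cd⌉₊ ^ j + 1 + a * k : ℕ) : ℝ≥0∞) * b) ^ 2 *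
        ((∫⁻ x, f x ^ 2 * W x ∂μ) * ∫⁻ x, g x ^ 2 * σ x ∂μ) := by
  classical
  have hstar : ∀ p ∈ s, ∃ m, B.star p ∈ T.cubes m := fun p hp => B.star_mem p (hs hp)
  have hstarm : ∀ p ∈ s, MeasurableSet (B.star p) := fun p hp =>
    let ⟨m, hm⟩ := hstar p hp; T.measurableSet_cube m _ hm
  have hstar0 : ∀ p ∈ s, μ (B.star p) ≠ 0 := fun p hp =>
    let ⟨m, hm⟩ := hstar p hp; T.measure_cube_ne_zero hX hδ' hm
  have hstart : ∀ p ∈ s, μ (B.star p) ≠ ∞ := fun p hp =>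
    let ⟨m, hm⟩ := hstar p hp; T.measure_cube_ne_top hX hC' hδ' hm
  have hQm : ∀ p ∈ s, MeasurableSet p.2 := fun p hp =>
    S.measurableSet_cube _ _ (B.mem_cubes (hs hp))
  obtain ⟨𝓕, h𝓕, hsp, hdom⟩ := exists_sparse_domination (μ := μ) (f := f) (Q := Prod.snd)
    (R := B.star) (L := fun p => qBall ρ (S.center p.1 p.2) (C₀ * (C + 1) * δ ^ p.1))
    (m := 8 * ⌈Cd⌉₊ ^ j + 1) (n := a * k) (c := ⌈Cd⌉₊ ^ j) (by omega) (by omega) s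
    (fun p hp => B.subset_star hC hδ (hs hp)) hstarm
    (fun p hp => hX.measurableSet_ball _ _)
    (fun p hp q hq => by
      obtain ⟨m, hm⟩ := hstar p hp
      obtain ⟨n, hn⟩ := hstar q hq
      exact T.nested m n _ hm _ hn)
    hstar0 hstart
    (fun p hp => h.setLIntegral_ne_top hf hf2 (hσ p (hs hp)))
    (fun t ht F hF htF => by
      have hinj : Set.InjOn Prod.snd (t : Set (ℤ × Set X)) := (B.sparse.injOn hX hC hδ).mono
        fun p hp => B.family_subset (hs (ht hp))
      have h1 := (B.sparse.isFinSparse t fun p hp => B.family_subset (hs (ht hp))).sum_measure_le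
        (F := B.star F) (fun A hA => by
          obtain ⟨p, hp, rfl⟩ := Finset.mem_image.1 hA
          exact (B.subset_star hC hδ (hs (ht hp))).trans (htF p hp)) (hstart F hF)
      rw [Finset.sum_image hinj] at h1
      calc _ ≤ ∑ p ∈ t, (⌈Cd⌉₊ : ℝ≥0∞) ^ j * μ p.2 := Finset.sum_le_sum fun p hp =>
            S.measure_ball_le hX hδ (B.mem_cubes (hs (ht hp))) hj
        _ = (⌈Cd⌉₊ : ℝ≥0∞) ^ j * ∑ p ∈ t, μ p.2 := (Finset.mul_sum _ _ _).symm
        _ ≤ (⌈Cd⌉₊ : ℝ≥0∞) ^ j * (2 * μ (B.star F)) := by gcongr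
        _ = _ := by push_cast; ring)
    (fun t ht q hq x hx hp => B.card_le hX hC hδ hδ1 hD ha hk t
      (fun p hp => hs (ht hp)) hx hp)
  set K : ℕ := 8 * ⌈Cd⌉₊ ^ j + 1 + a * k with hK
  have hle : ∑ p ∈ s, (∫⁻ x in B.star p, f x ∂μ) / μ (B.star p) * ∫⁻ x in p.2, g x ∂μ ≤
      4 * K * ∑ A ∈ 𝓕, (∫⁻ x in A, f x ∂μ) / μ A * ∫⁻ x in A, g x ∂μ := by
    rw [← lintegral_sum_indicator_mul hQm hg,
      ← lintegral_sum_indicator_mul hsp.measurableSet hg,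
      ← lintegral_const_mul' _ _ (ENNReal.mul_ne_top (by simp) (by simp))]
    refine lintegral_mono fun x => ?_
    simp only
    rw [← mul_assoc]
    exact mul_le_mul' (hdom x) le_rfl
  have hF : ∀ {P : Set X → Prop}, (∀ p ∈ s, P (B.star p)) → ∀ A ∈ 𝓕, P A := by
    intro P hP A hA
    obtain ⟨p, hp, rfl⟩ := h𝓕 A hA
    exact hP p hp
  calc _ ≤ (4 * K * ∑ A ∈ 𝓕, (∫⁻ x in A, f x ∂μ) / μ A * ∫⁻ x in A, g x ∂μ) ^ 2 := by gcongr
    _ = (4 * K) ^ 2 * (∑ A ∈ 𝓕, (∫⁻ x in A, f x ∂μ) / μ A * ∫⁻ x in A, g x ∂μ) ^ 2 :=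
        mul_pow _ _ _
    _ ≤ (4 * K) ^ 2 * ((8 * b) ^ 2 *
        ((∫⁻ x, f x ^ 2 * W x ∂μ) * ∫⁻ x, g x ^ 2 * σ x ∂μ)) := by
        gcongr
        exact h.sq_sparse_form_le hsp (hF hstar0) (hF hstart) (hF fun p hp => hW p (hs hp))
          (hF fun p hp => hσ p (hs hp))
          (hF (P := fun A => (∫⁻ x in A, W x ∂μ) * ∫⁻ x in A, σ x ∂μ ≤ b * μ A ^ 2)
            fun p hp => hb p (hs hp)) hf hg hf2 hg2
    _ = _ := by ring

end DiscreteOperator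

theorem enorm_setIntegral_div_le {X : Type*} [MeasurableSpace X] {μ : Measure X} (f : X → ℝ)
    (P : Set X) {A : Set X} (h0 : μ A ≠ 0) (ht : μ A ≠ ∞) :
    ‖(∫ y in P, f y ∂μ) / μ.real A‖ₑ ≤ (∫⁻ y in P, ‖f y‖ₑ ∂μ) / μ A := by
  have hr : 0 < μ.real A := ENNReal.toReal_pos h0 ht
  rw [div_eq_mul_inv, enorm_mul, enorm_inv hr.ne', Real.enorm_eq_ofReal hr.le,
    ofReal_measureReal ht, ← div_eq_mul_inv]
  gcongr
  exact enorm_integral_le_lintegral_enorm _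

theorem enorm_indicator_const_le {X : Type*} (A : Set X) {c : ℝ} {d : ℝ≥0∞} (h : ‖c‖ₑ ≤ d)
    (x : X) : ‖A.indicator (fun _ => c) x‖ₑ ≤ A.indicator (fun _ => d) x := by
  by_cases hx : x ∈ A <;> simp [hx, h]

namespace DiscreteOperator

variable {X : Type*} [MeasurableSpace X] {ρ : X → X → ℝ} {μ : Measure X}
  {C δ ε C' δ' ε' : ℝ} {S : DyadicDecomposition ρ μ C δ ε}
  {T : DyadicDecomposition ρ μ C' δ' ε'} {D : ℝ} {k : ℕ}

/-- A bound for the bilinear forms of the finite parts of an operator gives its `L²` bounds. -/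
theorem bounds_of_sq_form_le (B : DiscreteOperator S T D k) [Countable B.family]
    (hQ : ∀ p ∈ B.family, MeasurableSet p.2) (hQR : ∀ p ∈ B.family, p.2 ⊆ B.star p)
    (hR : ∀ p ∈ B.family, MeasurableSet (B.star p)) (h0 : ∀ p ∈ B.family, μ (B.star p) ≠ 0)
    (ht : ∀ p ∈ B.family, μ (B.star p) ≠ ∞) {w : X → ℝ} {σ : X → ℝ≥0∞}
    (h : IsDualPair μ (fun x => ENNReal.ofReal (w x)) σ)
    (hW : ∀ p ∈ B.family, ∫⁻ x in B.star p, ENNReal.ofReal (w x) ∂μ ≠ ∞)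
    (hσ : ∀ p ∈ B.family, ∫⁻ x in B.star p, σ x ∂μ ≠ ∞) {c : ℝ≥0∞} (hc : c ≠ ∞)
    (H : ∀ (s : Finset (ℤ × Set X)), ↑s ⊆ B.family → ∀ f g : X → ℝ≥0∞, AEMeasurable f μ →
      AEMeasurable g μ → ∫⁻ x, f x ^ 2 * ENNReal.ofReal (w x) ∂μ ≠ ∞ →
      ∫⁻ x, g x ^ 2 * σ x ∂μ ≠ ∞ →
      (∑ p ∈ s, (∫⁻ x in B.star p, f x ∂μ) / μ (B.star p) * ∫⁻ x in p.2, g x ∂μ) ^ 2 ≤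
        c ^ 2 * ((∫⁻ x, f x ^ 2 * ENNReal.ofReal (w x) ∂μ) * ∫⁻ x, g x ^ 2 * σ x ∂μ))
    (H' : ∀ (s : Finset (ℤ × Set X)), ↑s ⊆ B.family → ∀ f g : X → ℝ≥0∞, AEMeasurable f μ →
      AEMeasurable g μ → ∫⁻ x, f x ^ 2 * σ x ∂μ ≠ ∞ →
      ∫⁻ x, g x ^ 2 * ENNReal.ofReal (w x) ∂μ ≠ ∞ →
      (∑ p ∈ s, (∫⁻ x in B.star p, f x ∂μ) / μ (B.star p) * ∫⁻ x in p.2, g x ∂μ) ^ 2 ≤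
        c ^ 2 * ((∫⁻ x, f x ^ 2 * σ x ∂μ) * ∫⁻ x, g x ^ 2 * ENNReal.ofReal (w x) ∂μ))
    {f : X → ℝ} (hf : MemLp f 2 (weighted μ w)) :
    (∀ p ∈ B.family, IntegrableOn f (B.star p) μ) ∧
      ((∀ᵐ x ∂μ, Summable fun p : B.family => B.term f p x) ∧
        MemLp (B.op f) 2 (weighted μ w) ∧
        eLpNorm (B.op f) 2 (weighted μ w) ≤ c * eLpNorm f 2 (weighted μ w)) ∧
      ((∀ᵐ x ∂μ, Summable fun p : B.family => B.adjTerm f p x) ∧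
        MemLp (B.adj f) 2 (weighted μ w) ∧
        eLpNorm (B.adj f) 2 (weighted μ w) ≤ c * eLpNorm f 2 (weighted μ w)) := by
  classical
  -- Since `w > 0` almost everywhere, `μ` is absolutely continuous with respect to `w dμ`, so
  -- measurability transfers back.
  have hfm : AEStronglyMeasurable f μ := hf.1.mono_ac <| withDensity_absolutelyContinuous' h.left
    (h.mul_eq_one.mono fun x hx h0 => by simp [h0] at hx)
  have hN := eLpNorm_weighted_sq h.left hfm
  have hf2 : ∫⁻ x, ‖f x‖ₑ ^ 2 * ENNReal.ofReal (w x) ∂μ ≠ ∞ := by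
    rw [← hN]; exact ENNReal.pow_ne_top hf.2.ne
  have hfe : AEMeasurable (fun x => ‖f x‖ₑ) μ := hfm.enorm
  have hfR : ∀ p ∈ B.family, ∫⁻ x in B.star p, ‖f x‖ₑ ∂μ ≠ ∞ := fun p hp =>
    h.setLIntegral_ne_top hfe hf2 (hσ p hp)
  have hfQ : ∀ p ∈ B.family, ∫⁻ x in p.2, ‖f x‖ₑ ∂μ ≠ ∞ := fun p hp =>
    ne_top_of_le_ne_top (hfR p hp) (lintegral_mono_set (hQR p hp))
  have hc2 : c * eLpNorm f 2 (weighted μ w) ≠ ∞ := ENNReal.mul_ne_top hc hf.2.ne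
  have hmap : ∀ s : Finset B.family, ↑(s.map (Function.Embedding.subtype _)) ⊆ B.family := by
    intro s p hp
    obtain ⟨q, -, rfl⟩ := Finset.mem_map.1 (Finset.mem_coe.1 hp)
    exact q.2
  refine ⟨fun p hp => ⟨hfm.restrict, (hfR p hp).lt_top⟩, ?_, ?_⟩
  · refine memLp_tsum_of_lintegral_le h (u := fun p : B.family => B.term f p)
      (v := fun p : B.family => p.1.2.indicator fun _ =>
        (∫⁻ y in B.star p, ‖f y‖ₑ ∂μ) / μ (B.star p))
      (fun p => measurable_const.indicator (hQ p p.2))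
      (fun p => measurable_const.indicator (hQ p p.2))
      (fun p x => enorm_indicator_const_le _
        (enorm_setIntegral_div_le f _ (h0 p p.2) (ht p p.2)) x) hc2 ?_
    refine h.lintegral_sq_tsum_le (ι := B.family)
      (fun p => measurable_const.indicator (hQ p p.2)) fun s => ?_
    refine h.lintegral_sq_sum_indicator_le (ι := B.family) (fun p _ => hQ p p.2)
      (fun p _ => ENNReal.div_ne_top (hfR p p.2) (h0 p p.2))
      (fun p _ => ne_top_of_le_ne_top (hW p p.2) (lintegral_mono_set (hQR p p.2)))
      fun g hg hg2 => ?_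
    have := H _ (hmap s) _ g hfe hg hf2 hg2
    rw [Finset.sum_map] at this
    rw [mul_pow, hN, mul_assoc]
    exact this
  · refine memLp_tsum_of_lintegral_le h (u := fun p : B.family => B.adjTerm f p)
      (v := fun p : B.family => (B.star p).indicator fun _ =>
        (∫⁻ y in p.1.2, ‖f y‖ₑ ∂μ) / μ (B.star p))
      (fun p => measurable_const.indicator (hR p p.2))
      (fun p => measurable_const.indicator (hR p p.2))
      (fun p x => enorm_indicator_const_le _
        (enorm_setIntegral_div_le f _ (h0 p p.2) (ht p p.2)) x) hc2 ?_
    refine h.lintegral_sq_tsum_le (ι := B.family)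
      (fun p => measurable_const.indicator (hR p p.2)) fun s => ?_
    refine h.lintegral_sq_sum_indicator_le (ι := B.family) (fun p _ => hR p p.2)
      (fun p _ => ENNReal.div_ne_top (hfQ p p.2) (h0 p p.2)) (fun p _ => hW p p.2)
      fun g hg hg2 => ?_
    -- The adjoint tested against `g` is the same form with `g` averaged over `Q^*`, so `f` and `g`
    -- exchange places.
    have := H' _ (hmap s) g _ hg hfe hg2 hf2
    rw [Finset.sum_map] at this
    rw [mul_pow, hN, mul_assoc, mul_comm (∫⁻ x, ‖f x‖ₑ ^ 2 * ENNReal.ofReal (w x) ∂μ)]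
    refine le_of_eq_of_le ?_ this
    congr 1
    refine Finset.sum_congr rfl fun p _ => ?_
    rw [Function.Embedding.subtype_apply, div_eq_mul_inv, div_eq_mul_inv]
    ring

end DiscreteOperator

/-! ### Choice of constants and conclusion. -/

theorem mainTheorem5 {X : Type*} [MeasurableSpace X] (ρ : X → X → ℝ) (μ : Measure X)
    (C₀ Cd : ℝ) (hX : IsHomogeneousSpace ρ μ C₀ Cd)
    (C δ ε C' δ' ε' D : ℝ)
    (hC : 0 < C) (hδ : 0 < δ) (hδ1 : δ < 1) (hε : 0 < ε) (hε1 : ε < 1)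
    (hC' : 0 < C') (hδ' : 0 < δ') (hδ1' : δ' < 1) (hε' : 0 < ε') (hε1' : ε' < 1)
    (hD : 0 < D) :
    ∃ D₇ : ℝ, 0 < D₇ ∧
      ∀ (S : DyadicDecomposition ρ μ C δ ε) (T : DyadicDecomposition ρ μ C' δ' ε')
        (k : ℕ), 1 ≤ k → ∀ (B : DiscreteOperator S T D k)
        (w : X → ℝ), IsA2Weight ρ μ w →
        ∀ f : X → ℝ, MemLp f 2 (weighted μ w) →
          (∀ p ∈ B.family, IntegrableOn f (B.star p) μ) ∧
          ((∀ᵐ x ∂μ, Summable fun p : B.family => B.term f p x) ∧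
            MemLp (B.op f) 2 (weighted μ w) ∧
            eLpNorm (B.op f) 2 (weighted μ w) ≤
              ENNReal.ofReal (D₇ * k) * a2Char ρ μ w * eLpNorm f 2 (weighted μ w)) ∧
          ((∀ᵐ x ∂μ, Summable fun p : B.family => B.adjTerm f p x) ∧
            MemLp (B.adj f) 2 (weighted μ w) ∧
            eLpNorm (B.adj f) 2 (weighted μ w) ≤
              ENNReal.ofReal (D₇ * k) * a2Char ρ μ w * eLpNorm f 2 (weighted μ w)) := by
  obtain ⟨a, ha⟩ : ∃ a : ℕ, δ ^ a < (2 * (D * C + 1))⁻¹ :=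
    exists_pow_lt_of_lt_one (by positivity) hδ1
  obtain ⟨j, hj⟩ : ∃ j : ℕ, C₀ * (C + 1) < 2 ^ j := pow_unbounded_of_one_lt _ one_lt_two
  obtain ⟨i, hi⟩ : ∃ i : ℕ, C' < 2 ^ i := pow_unbounded_of_one_lt _ one_lt_two
  -- The factor `32 = 4 · 8` combines sparse domination with the sparse form bound, and `⌈Cd⌉₊ ^ (2
  -- * i)` passes from balls to cubes of `T`. The last `+ 1` makes the constant visibly positive.
  set E : ℕ := 32 * (8 * ⌈Cd⌉₊ ^ j + 1 + a) * ⌈Cd⌉₊ ^ (2 * i) + 1 with hE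
  refine ⟨E, by positivity, fun S T k hk B w hw f hf => ?_⟩
  have : Countable B.family := B.countable_family hX hδ
  -- The root cube supplies a point of `X`.
  have h := hw.isDualPair (S.center B.root.1 B.root.2)
  have hstar : ∀ p ∈ B.family, ∃ m, B.star p ∈ T.cubes m ∧ 0 < C' * δ' ^ m := fun p hp =>
    let ⟨m, hm⟩ := B.star_mem p hp; ⟨m, hm, mul_pos hC' (zpow_pos hδ' m)⟩
  have hW : ∀ p ∈ B.family, ∫⁻ x in B.star p, ENNReal.ofReal (w x) ∂μ ≠ ∞ := fun p hp =>
    let ⟨m, hm, hr⟩ := hstar p hp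
    ne_top_of_le_ne_top (hw.lintegral_ball_ne_top _ hr) (lintegral_mono_set (T.subset_ball m _ hm))
  have hσ : ∀ p ∈ B.family, ∫⁻ x in B.star p, (ENNReal.ofReal (w x))⁻¹ ∂μ ≠ ∞ := fun p hp =>
    let ⟨m, hm, hr⟩ := hstar p hp
    ne_top_of_le_ne_top (hw.lintegral_inv_ball_ne_top hX _ hr)
      (lintegral_mono_set (T.subset_ball m _ hm))
  have hb : ∀ p ∈ B.family, (∫⁻ x in B.star p, ENNReal.ofReal (w x) ∂μ) *
      ∫⁻ x in B.star p, (ENNReal.ofReal (w x))⁻¹ ∂μ ≤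
      ((⌈Cd⌉₊ : ℝ≥0∞) ^ (2 * i) * a2Char ρ μ w) * μ (B.star p) ^ 2 := fun p hp =>
    let ⟨m, hm, _⟩ := hstar p hp
    IsA2Weight.mul_cube_le hX hC' hδ' T hm hi.le
  have hle : 32 * ((8 * ⌈Cd⌉₊ ^ j + 1 + a * k : ℕ) : ℝ≥0∞) *
      ((⌈Cd⌉₊ : ℝ≥0∞) ^ (2 * i) * a2Char ρ μ w) ≤ ENNReal.ofReal (E * k) * a2Char ρ μ w := by
    have h1 : 32 * (8 * ⌈Cd⌉₊ ^ j + 1 + a * k) * ⌈Cd⌉₊ ^ (2 * i) ≤ E * k := by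
      calc 32 * (8 * ⌈Cd⌉₊ ^ j + 1 + a * k) * ⌈Cd⌉₊ ^ (2 * i)
          ≤ 32 * ((8 * ⌈Cd⌉₊ ^ j + 1 + a) * k) * ⌈Cd⌉₊ ^ (2 * i) := by
            gcongr
            rw [add_mul]
            gcongr
            exact Nat.le_mul_of_pos_right _ hk
        _ = 32 * (8 * ⌈Cd⌉₊ ^ j + 1 + a) * ⌈Cd⌉₊ ^ (2 * i) * k := by ring
        _ ≤ E * k := by gcongr; omega
    have h2 : ENNReal.ofReal (E * k) = ((E * k : ℕ) : ℝ≥0∞) := by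
      rw [← Nat.cast_mul, ENNReal.ofReal_natCast]
    rw [h2, ← mul_assoc]
    gcongr
    exact_mod_cast h1
  refine B.bounds_of_sq_form_le (fun p hp => S.measurableSet_cube _ _ (B.mem_cubes hp))
    (fun p hp => B.subset_star hC hδ hp)
    (fun p hp => let ⟨m, hm, _⟩ := hstar p hp; T.measurableSet_cube m _ hm)
    (fun p hp => let ⟨m, hm, _⟩ := hstar p hp; T.measure_cube_ne_zero hX hδ' hm)
    (fun p hp => let ⟨m, hm, _⟩ := hstar p hp; T.measure_cube_ne_top hX hC' hδ' hm)
    h hW hσ (ENNReal.mul_ne_top ENNReal.ofReal_ne_top hw.a2Char_lt_top.ne)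
    (fun s hs u v hu hv hu2 hv2 => ?_) (fun s hs u v hu hv hu2 hv2 => ?_) hf
  · refine (B.sq_form_le hX hC hδ hδ1 hC' hδ' hD ha.le hj.le hk h hW hσ hb s hs hu hv hu2
      hv2).trans ?_
    gcongr
  · refine (B.sq_form_le hX hC hδ hδ1 hC' hδ' hD ha.le hj.le hk h.symm hσ hW
      (fun p hp => by rw [mul_comm (∫⁻ x in B.star p, _ ∂μ)]; exact hb p hp)
      s hs hu hv hu2 hv2).trans ?_
    gcongr
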